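/- Let $\{a,b\}^*$ be the set of all finite words over the alphabet $\{a,b\}$. A right ideal is a set $R\subseteq\{a,b\}^*$ with $ux\in R$ for all $u\in R$, $x\in\{a,b\}^*$; its prefix code is the set of those words of $R$ that have no strict prefix in $R$. $R$ is finitely generated if its prefix code is finite, and essential if it meets every nonempty right ideal. A right-ideal isomorphism is a bijection $\varphi:R_1\to R_2$ between right ideals such that $\varphi(ux)=\varphi(u)x$ for all $u\in R_1$, $x\in\{a,b\}^*$; it is maximal if no right-ideal isomorphism strictly extends it. The Thompson group $V$ consists of all maximal isomorphisms between finitely generated essential right ideals of $\{a,b\}^*$; the product $gh$ is the (unique) maximal extension of the composite $g\circ h$. The table size $\|g\|$ of $g\in V$ is the cardinality of the prefix code of the domain of $g$. Theorem. Let $\Delta$ be a finite set of generators of $V$, and for $g\in V$ let $|g|_\Delta$ be the length of a shortest word over $\Delta\cup\Delta^{-1}$ that represents $g$. (1) There are constants $c_\Delta,c'_\Delta>0$ (depending on $\Delta$ only) such that for all $g\in V\setminus\{\mathbf 1\}$ $$c'_\Delta\,\|g\|\ \le\ |g|_\Delta\ \le\ c_\Delta\,\|g\|\cdot\log_2\|g\|.$$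 (2) For almost all $g\in V$, $|g|_\Delta>\|g\|\cdot\log_{2|\Delta|}\|g\|$. That is: for every $n\ge 1$ the set $\{g\in V:\|g\|=n\}$ is finite and nonempty, and the proportion in it of the elements $g$ that do not satisfy this inequality tends to $0$ exponentially fast as $n\to\infty$; i.e. there are constants $C>0$ and $0<r<1$ (depending on $\Delta$ only) such that this proportion is at most $C\,r^n$ for all $n\ge 1$. -/

import Mathlib

namespace Thompson

/-- Words over the two-letter alphabet `{a, b}`; the two letters are the two Booleans.
Concatenation is `++`, the empty word is `[]`, and `u <+: v` says that `u` is a prefix of `v`. -/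
abbrev Word : Type := List Bool

/-- Right ideals of the free monoid: `R · A* ⊆ R`. -/
def IsRightIdeal (R : Set Word) : Prop :=
  ∀ u ∈ R, ∀ x : Word, u ++ x ∈ R

/-- A right ideal is essential if it meets every (nonempty) right ideal. -/
def IsEssential (R : Set Word) : Prop :=
  IsRightIdeal R ∧ ∀ J : Set Word, IsRightIdeal J → J.Nonempty → (R ∩ J).Nonempty

/-- The prefix code of a right ideal `R`: the words of `R` without a strict prefix in `R`.
It is the unique prefix code that generates `R` as a right ideal. -/
def code (R : Set Word) : Set Word :=
  {u | u ∈ R ∧ ∀ v ∈ R, v <+: u → v = u}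

/-- Finitely generated essential right ideals. -/
def IsFGEssential (R : Set Word) : Prop :=
  IsEssential R ∧ (code R).Finite

/-- Domain of a partial bijection. -/
def dom (f : Word ≃. Word) : Set Word := {u | ∃ v, v ∈ f u}

/-- Image of a partial bijection. -/
def im (f : Word ≃. Word) : Set Word := {v | ∃ u, v ∈ f u}

/-- Right-ideal isomorphisms: bijections `f : R₁ → R₂` between right ideals with
`f (u x) = f (u) x` for all `u ∈ R₁` and all words `x`. -/
structure IsRightIdealIso (f : Word ≃. Word) : Prop where
  dom_ideal : IsRightIdeal (dom f)
  im_ideal : IsRightIdeal (im f)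
  map_append : ∀ u v : Word, v ∈ f u → ∀ x : Word, v ++ x ∈ f (u ++ x)

/-- Right-ideal isomorphisms between finitely generated essential right ideals. -/
structure IsFGEssentialIso (f : Word ≃. Word) : Prop where
  iso : IsRightIdealIso f
  dom_fg : IsFGEssential (dom f)
  im_fg : IsFGEssential (im f)

/-- Right-ideal isomorphisms without strict extension to a right-ideal isomorphism.  The order
of `Word ≃. Word` is extension of partial maps. -/
def IsMaximalIso (f : Word ≃. Word) : Prop := Maximal IsRightIdealIso f

/-! ### Facts about right ideals -/

theorem exists_code_prefix {R : Set Word} {u : Word} (hu : u ∈ R) :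
    ∃ p ∈ code R, p <+: u := by
  induction h : u.length using Nat.strong_induction_on generalizing u with
  | _ n ih =>
    by_cases hc : u ∈ code R
    · exact ⟨u, hc, List.prefix_rfl⟩
    · have : ∃ v ∈ R, v <+: u ∧ v ≠ u := by
        by_contra hno
        push Not at hno
        exact hc ⟨hu, hno⟩
      obtain ⟨v, hv, hvu, hne⟩ := this
      have hlt : v.length < n := by
        rw [← h]
        exact lt_of_le_of_ne hvu.length_le (fun e => hne (hvu.eq_of_length e))
      obtain ⟨p, hp, hpv⟩ := ih _ hlt hv rfl
      exact ⟨p, hp, hpv.trans hvu⟩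

theorem isEssential_iff {R : Set Word} :
    IsEssential R ↔ IsRightIdeal R ∧ ∀ u : Word, ∃ x : Word, u ++ x ∈ R := by
  constructor
  · rintro ⟨hR, h⟩
    refine ⟨hR, fun u => ?_⟩
    obtain ⟨w, hw, x, rfl⟩ := h {w | ∃ x, w = u ++ x}
      (by rintro w ⟨x, rfl⟩ y; exact ⟨x ++ y, by simp⟩) ⟨u, [], by simp⟩
    exact ⟨x, hw⟩
  · rintro ⟨hR, h⟩
    refine ⟨hR, fun J hJ ⟨u, hu⟩ => ?_⟩
    obtain ⟨x, hx⟩ := h u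
    exact ⟨u ++ x, hx, hJ u hu x⟩

/-- A right ideal is essential and finitely generated iff its complement is finite. -/
theorem isFGEssential_iff {R : Set Word} :
    IsFGEssential R ↔ IsRightIdeal R ∧ Rᶜ.Finite := by
  rw [IsFGEssential, isEssential_iff]
  constructor
  · rintro ⟨⟨hR, he⟩, hf⟩
    refine ⟨hR, (hf.biUnion (t := fun p => {u | u ∈ p.inits})
      (fun p _ => List.finite_toSet p.inits)).subset fun u hu => ?_⟩
    obtain ⟨x, hx⟩ := he u
    obtain ⟨p, hp, hpx⟩ := exists_code_prefix hx
    rcases List.prefix_or_prefix_of_prefix hpx (List.prefix_append u x) with h | ⟨y, hy⟩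
    · obtain ⟨y, rfl⟩ := h
      exact absurd (hR p hp.1 y) hu
    · simp only [Set.mem_iUnion, Set.mem_ofPred_eq, List.mem_inits]
      exact ⟨p, hp, y, hy⟩
  · rintro ⟨hR, hf⟩
    refine ⟨⟨hR, fun u => ?_⟩, ?_⟩
    · by_contra hno
      push Not at hno
      refine (Set.infinite_of_injective_forall_mem (f := fun n : ℕ => u ++ List.replicate n true)
        ?_ fun n => hno _) hf
      intro m n h
      simpa using congrArg List.length h
    · refine ((hf.image2 (fun u a => u ++ [a]) (Set.finite_univ (α := Bool))).union
        (Set.finite_singleton [])).subset fun u hu => ?_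
      rcases List.eq_nil_or_concat u with rfl | ⟨v, a, rfl⟩
      · exact Or.inr rfl
      · left
        rw [List.concat_eq_append] at hu ⊢
        refine ⟨v, fun hv => ?_, a, trivial, rfl⟩
        have := hu.2 v hv (List.prefix_append v [a])
        simp at this

theorem IsFGEssential.mono {R S : Set Word} (hR : IsFGEssential R) (hS : IsRightIdeal S)
    (h : R ⊆ S) : IsFGEssential S := by
  rw [isFGEssential_iff] at *
  exact ⟨hS, hR.2.subset (Set.compl_subset_compl.2 h)⟩

/-! ### Facts about right-ideal isomorphisms -/

theorem dom_symm (f : Word ≃. Word) : dom f.symm = im f := by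
  ext u
  exact exists_congr fun _ => PEquiv.mem_iff_mem f

theorem im_symm (f : Word ≃. Word) : im f.symm = dom f := by
  ext u
  exact exists_congr fun _ => PEquiv.mem_iff_mem f

theorem isRightIdealIso_of_map {f : Word ≃. Word}
    (h : ∀ u v : Word, v ∈ f u → ∀ x : Word, v ++ x ∈ f (u ++ x)) : IsRightIdealIso f where
  dom_ideal := fun _ ⟨v, hv⟩ x => ⟨v ++ x, h _ _ hv x⟩
  im_ideal := fun _ ⟨u, hu⟩ x => ⟨u ++ x, h _ _ hu x⟩
  map_append := h

theorem IsRightIdealIso.symm {f : Word ≃. Word} (hf : IsRightIdealIso f) :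
    IsRightIdealIso f.symm :=
  isRightIdealIso_of_map fun _ _ h x =>
    (PEquiv.mem_iff_mem f).2 (hf.map_append _ _ ((PEquiv.mem_iff_mem f).1 h) x)

theorem IsRightIdealIso.trans {f g : Word ≃. Word} (hf : IsRightIdealIso f)
    (hg : IsRightIdealIso g) : IsRightIdealIso (f.trans g) := by
  refine isRightIdealIso_of_map fun u w h x => ?_
  obtain ⟨v, hv, hw⟩ := (PEquiv.mem_trans f g u w).1 h
  exact (PEquiv.mem_trans f g _ _).2
    ⟨v ++ x, hf.map_append _ _ hv x, hg.map_append _ _ hw x⟩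

theorem isRightIdealIso_refl : IsRightIdealIso (PEquiv.refl Word) :=
  isRightIdealIso_of_map fun u v h x => by
    simp only [PEquiv.refl_apply, Option.mem_some_iff] at h ⊢
    rw [h]

theorem IsFGEssentialIso.symm {f : Word ≃. Word} (hf : IsFGEssentialIso f) :
    IsFGEssentialIso f.symm :=
  ⟨hf.iso.symm, by rw [dom_symm]; exact hf.im_fg, by rw [im_symm]; exact hf.dom_fg⟩

theorem dom_trans_fg {f g : Word ≃. Word} (hf : IsFGEssentialIso f) (hg : IsFGEssentialIso g) :
    IsFGEssential (dom (f.trans g)) := by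
  rw [isFGEssential_iff]
  refine ⟨(hf.iso.trans hg.iso).dom_ideal, ?_⟩
  have h1 := (isFGEssential_iff.1 hf.dom_fg).2
  have h2 := (isFGEssential_iff.1 hg.dom_fg).2
  refine (h1.union (h2.biUnion (t := fun v => {u | v ∈ f u}) fun v _ =>
    Set.Subsingleton.finite fun a ha b hb => f.inj ha hb)).subset fun u hu => ?_
  by_cases hd : u ∈ dom f
  · right
    obtain ⟨v, hv⟩ := hd
    simp only [Set.mem_iUnion]
    exact ⟨v, fun ⟨w, hw⟩ => hu ⟨w, (PEquiv.mem_trans f g u w).2 ⟨v, hv, hw⟩⟩, hv⟩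
  · exact Or.inl hd

theorem IsFGEssentialIso.trans {f g : Word ≃. Word} (hf : IsFGEssentialIso f)
    (hg : IsFGEssentialIso g) : IsFGEssentialIso (f.trans g) := by
  refine ⟨hf.iso.trans hg.iso, dom_trans_fg hf hg, ?_⟩
  rw [← dom_symm, PEquiv.symm_trans_rev]
  exact dom_trans_fg hg.symm hf.symm

theorem isFGEssentialIso_refl : IsFGEssentialIso (PEquiv.refl Word) := by
  have h : dom (PEquiv.refl Word) = Set.univ :=
    Set.eq_univ_of_forall fun u => ⟨u, by simp⟩
  have h2 : IsFGEssential (dom (PEquiv.refl Word)) := by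
    rw [isFGEssential_iff, h]
    exact ⟨fun _ _ _ => trivial, by simp⟩
  exact ⟨isRightIdealIso_refl, h2, by rw [← dom_symm]; exact h2⟩

theorem dom_mono {f g : Word ≃. Word} (h : f ≤ g) : dom f ⊆ dom g :=
  fun u ⟨v, hv⟩ => ⟨v, h u v hv⟩

theorem im_mono {f g : Word ≃. Word} (h : f ≤ g) : im f ⊆ im g :=
  fun v ⟨u, hu⟩ => ⟨u, h u v hu⟩

theorem symm_mono {f g : Word ≃. Word} (h : f ≤ g) : f.symm ≤ g.symm :=
  fun u v hv => (PEquiv.mem_iff_mem g).2 (h v u ((PEquiv.mem_iff_mem f).1 hv))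

theorem trans_mono {f f₁ g g₁ : Word ≃. Word} (hf : f ≤ f₁) (hg : g ≤ g₁) :
    f.trans g ≤ f₁.trans g₁ := fun u w h => by
  obtain ⟨v, hv, hw⟩ := (PEquiv.mem_trans f g u w).1 h
  exact (PEquiv.mem_trans f₁ g₁ u w).2 ⟨v, hf u v hv, hg v w hw⟩

theorem IsFGEssentialIso.mono {f g : Word ≃. Word} (hf : IsFGEssentialIso f)
    (hg : IsRightIdealIso g) (h : f ≤ g) : IsFGEssentialIso g :=
  ⟨hg, hf.dom_fg.mono hg.dom_ideal (dom_mono h), hf.im_fg.mono hg.im_ideal (im_mono h)⟩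

/-- Two extensions of the same isomorphism agree where both are defined. -/
theorem extension_unique {f g h : Word ≃. Word} (hf : IsFGEssentialIso f)
    (hg : IsRightIdealIso g) (hh : IsRightIdealIso h) (hfg : f ≤ g) (hfh : f ≤ h)
    {u v w : Word} (hv : v ∈ g u) (hw : w ∈ h u) : v = w := by
  obtain ⟨x, y, hy⟩ := (isEssential_iff.1 hf.dom_fg.1).2 u
  have h1 := Option.mem_unique (hfg _ _ hy) (hg.map_append _ _ hv x)
  have h2 := Option.mem_unique (hfh _ _ hy) (hh.map_append _ _ hw x)
  exact List.append_cancel_right (h1.symm.trans h2)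

/-- An isomorphism between finitely generated essential right ideals has exactly one maximal
extension. -/
theorem existsUnique_maximal {f : Word ≃. Word} (hf : IsFGEssentialIso f) :
    ∃! g : Word ≃. Word, IsMaximalIso g ∧ f ≤ g := by
  classical
  let r : Word → Word → Prop := fun u v => ∃ g, IsRightIdealIso g ∧ f ≤ g ∧ v ∈ g u
  have r1 : ∀ u v w, r u v → r u w → v = w := by
    rintro u v w ⟨g, hg, hfg, hv⟩ ⟨h, hh, hfh, hw⟩
    exact extension_unique hf hg hh hfg hfh hv hw
  have r2 : ∀ u v w, r u w → r v w → u = v := by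
    rintro u v w ⟨g, hg, hfg, hv⟩ ⟨h, hh, hfh, hw⟩
    exact extension_unique hf.symm hg.symm hh.symm (symm_mono hfg) (symm_mono hfh)
      ((PEquiv.mem_iff_mem g).2 hv) ((PEquiv.mem_iff_mem h).2 hw)
  let F : Word ≃. Word :=
    { toFun := fun u => if h : ∃ v, r u v then some h.choose else none
      invFun := fun v => if h : ∃ u, r u v then some h.choose else none
      inv := by
        intro u v
        have e1 : (u ∈ (if h : ∃ u, r u v then some h.choose else none)) ↔ r u v := by
          split_ifs with h
          · rw [Option.mem_some_iff]
            exact ⟨fun e => e ▸ h.choose_spec, fun e => r2 _ _ _ h.choose_spec e⟩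
          · simpa using fun e => h ⟨u, e⟩
        have e2 : (v ∈ (if h : ∃ v, r u v then some h.choose else none)) ↔ r u v := by
          split_ifs with h
          · rw [Option.mem_some_iff]
            exact ⟨fun e => e ▸ h.choose_spec, fun e => r1 _ _ _ h.choose_spec e⟩
          · simpa using fun e => h ⟨v, e⟩
        exact e1.trans e2.symm }
  have hF : ∀ u v, v ∈ F u ↔ r u v := by
    intro u v
    change (v ∈ (if h : ∃ v, r u v then some h.choose else none)) ↔ r u v
    split_ifs with h
    · rw [Option.mem_some_iff]
      exact ⟨fun e => e ▸ h.choose_spec, fun e => r1 _ _ _ h.choose_spec e⟩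
    · simpa using fun e => h ⟨v, e⟩
  have hle : ∀ g, IsRightIdealIso g → f ≤ g → g ≤ F := fun g hg hfg u v hv =>
    (hF u v).2 ⟨g, hg, hfg, hv⟩
  have hiso : IsRightIdealIso F := by
    refine isRightIdealIso_of_map fun u v h x => ?_
    obtain ⟨g, hg, hfg, hv⟩ := (hF u v).1 h
    exact (hF _ _).2 ⟨g, hg, hfg, hg.map_append _ _ hv x⟩
  have hfF : f ≤ F := hle f hf.iso le_rfl
  refine ⟨F, ⟨⟨hiso, fun g hg hFg => hle g hg (hfF.trans hFg)⟩, hfF⟩, ?_⟩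
  rintro g ⟨hg, hfg⟩
  exact le_antisymm (hle g hg.1 hfg) (hg.2 hiso (hle g hg.1 hfg))

/-- The maximum extension of an isomorphism between finitely generated essential right
ideals. -/
noncomputable def maxExt (f : Word ≃. Word) (hf : IsFGEssentialIso f) : Word ≃. Word :=
  (existsUnique_maximal hf).choose

theorem isMaximalIso_maxExt {f : Word ≃. Word} (hf : IsFGEssentialIso f) :
    IsMaximalIso (maxExt f hf) := (existsUnique_maximal hf).choose_spec.1.1

theorem le_maxExt {f : Word ≃. Word} (hf : IsFGEssentialIso f) : f ≤ maxExt f hf :=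
  (existsUnique_maximal hf).choose_spec.1.2

theorem isFGEssentialIso_maxExt {f : Word ≃. Word} (hf : IsFGEssentialIso f) :
    IsFGEssentialIso (maxExt f hf) := hf.mono (isMaximalIso_maxExt hf).1 (le_maxExt hf)

theorem isMaximalIso_refl : IsMaximalIso (PEquiv.refl Word) := by
  refine ⟨isRightIdealIso_refl, fun g _ h u v hv => ?_⟩
  have := h u u (by simp)
  rw [Option.mem_unique hv this]
  simp

theorem IsMaximalIso.symm {f : Word ≃. Word} (hf : IsMaximalIso f) : IsMaximalIso f.symm :=
  ⟨hf.1.symm, fun g hg h => symm_mono (hf.2 hg.symm (symm_mono h))⟩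

/-! ### The group -/

/-- The Thompson group `V`: its elements are the maximal isomorphisms between finitely generated
essential right ideals of `{a, b}*`. -/
@[ext]
structure V : Type where
  toPEquiv : Word ≃. Word
  isFGEssentialIso : IsFGEssentialIso toPEquiv
  isMaximalIso : IsMaximalIso toPEquiv

/-- The product `g * h` is the maximum extension of the composite `g ∘ h` (`h` is applied
first). -/
noncomputable instance : Mul V where
  mul g h :=
    ⟨maxExt (h.toPEquiv.trans g.toPEquiv) (h.isFGEssentialIso.trans g.isFGEssentialIso),
      isFGEssentialIso_maxExt _, isMaximalIso_maxExt _⟩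

instance : One V where
  one := ⟨PEquiv.refl Word, isFGEssentialIso_refl, isMaximalIso_refl⟩

instance : Inv V where
  inv g := ⟨g.toPEquiv.symm, g.isFGEssentialIso.symm, g.isMaximalIso.symm⟩

theorem V.trans_le_mul (g h : V) : h.toPEquiv.trans g.toPEquiv ≤ (g * h).toPEquiv :=
  le_maxExt (h.isFGEssentialIso.trans g.isFGEssentialIso)

theorem V.eq_of_le {f : Word ≃. Word} (hf : IsFGEssentialIso f) {g h : V}
    (hg : f ≤ g.toPEquiv) (hh : f ≤ h.toPEquiv) : g = h :=
  V.ext ((existsUnique_maximal hf).unique ⟨g.isMaximalIso, hg⟩ ⟨h.isMaximalIso, hh⟩)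

noncomputable instance : Group V :=
  Group.ofLeftAxioms
    (fun g h k => by
      refine V.eq_of_le
        (k.isFGEssentialIso.trans (h.isFGEssentialIso.trans g.isFGEssentialIso)) ?_ ?_
      · exact (trans_mono le_rfl (V.trans_le_mul g h)).trans (V.trans_le_mul (g * h) k)
      · rw [← PEquiv.trans_assoc]
        exact (trans_mono (V.trans_le_mul h k) le_rfl).trans (V.trans_le_mul g (h * k)))
    (fun g => by
      refine V.eq_of_le (g.isFGEssentialIso.trans isFGEssentialIso_refl)
        (V.trans_le_mul 1 g) ?_
      rw [PEquiv.trans_refl])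
    (fun g => by
      refine V.eq_of_le (g.isFGEssentialIso.trans g.isFGEssentialIso.symm)
        (V.trans_le_mul g⁻¹ g) ?_
      intro u w h
      obtain ⟨v, hv, hw⟩ := (PEquiv.mem_trans _ _ u w).1 h
      have := g.toPEquiv.inj hv ((PEquiv.mem_iff_mem _).1 hw)
      subst this
      change u ∈ PEquiv.refl Word u
      simp)

/-- The table size of `g`: the cardinality of the (finite) domain code of the maximal right-ideal
isomorphism `g`. -/
noncomputable def tableSize (g : V) : ℕ := (code (dom g.toPEquiv)).ncard

/-- The word length of `g` over `Δ`: the least length of a word over `Δ ∪ Δ⁻¹` that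
represents `g`. -/
noncomputable def wordLength (Δ : Finset V) (g : V) : ℕ :=
  sInf {n : ℕ | ∃ l : List V, (∀ s ∈ l, s ∈ Δ ∨ s⁻¹ ∈ Δ) ∧ l.prod = g ∧ l.length = n}

end Thompson

/-! An element of `V` is a bijection between the leaves of two finite binary trees, encoded as a
pair of labelled trees (`Tab`). All three estimates come from this picture.

Lower bound: a table of size n has n - 1 inner vertices, and these are the words outside the domain
(`ncard_code`). The composite of two elements is undefined at no more words than the two together,
so `tableSize - 1` is subadditive and grows at most linearly in the word length.

Upper bound: transform one labelled tree into the other by divide and conquer. Two-colour the labels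
into halves; working from the leaves up, all labels of one colour are brought to the left of the
root at constant cost per inner vertex (`exists_sorted`). Doing this to both trees and recursing
below the root costs O(n) per level on about log n levels (`cost_le`). Depth is not charged: the
copy of g two steps down is a conjugate of the copy one step down by a single rotation (`sub_sub`),
so control of both g and `sub g` passes to subtrees with a constant surcharge.

Counting: with d generators, at most 2d n^n elements have length at most n log n, the logarithm
being to base 2d (`ncard_wordLength_le_mul_logb`). With n = m + 1, at least `catalan m * m!`
elements have table size n (`catalan_mul_factorial_le_ncard`). Up to a polynomial factor the latter
is (4n/e)^n, so the proportion of exceptions is a polynomial times (e/4)^n; since e < 3, the rate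
3/4 absorbs the polynomial. -/

namespace Thompson

/-! ### Cofinite right ideals and partial bijections -/

/-- A relation that is functional in both directions, as a partial bijection. -/
theorem exists_pequiv_of_rel (r : Word → Word → Prop)
    (r1 : ∀ u v w, r u v → r u w → v = w) (r2 : ∀ u v w, r u w → r v w → u = v) :
    ∃ F : Word ≃. Word, ∀ u v, v ∈ F u ↔ r u v := by
  classical
  have e1 : ∀ u v, (v ∈ (if h : ∃ v, r u v then some h.choose else none)) ↔ r u v := by
    intro u v
    split_ifs with h
    · rw [Option.mem_some_iff]
      exact ⟨fun e => e ▸ h.choose_spec, fun e => r1 _ _ _ h.choose_spec e⟩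
    · simpa using fun e => h ⟨v, e⟩
  have e2 : ∀ u v, (u ∈ (if h : ∃ u, r u v then some h.choose else none)) ↔ r u v := by
    intro u v
    split_ifs with h
    · rw [Option.mem_some_iff]
      exact ⟨fun e => e ▸ h.choose_spec, fun e => r2 _ _ _ h.choose_spec e⟩
    · simpa using fun e => h ⟨u, e⟩
  exact ⟨{ toFun := fun u => if h : ∃ v, r u v then some h.choose else none
           invFun := fun v => if h : ∃ u, r u v then some h.choose else none
           inv := fun u v => (e2 u v).trans (e1 u v).symm }, e1⟩

theorem exists_length_le_of_finite_compl {R : Set Word} (h : Rᶜ.Finite) :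
    ∃ N, ∀ u : Word, N ≤ u.length → u ∈ R := by
  obtain ⟨N, hN⟩ := (h.image List.length).bddAbove
  refine ⟨N + 1, fun u hu => ?_⟩
  by_contra hc
  have : u.length ≤ N := hN ⟨u, hc, rfl⟩
  omega

theorem finite_compl_of_length_le {R : Set Word} (N : ℕ)
    (h : ∀ u : Word, N ≤ u.length → u ∈ R) : Rᶜ.Finite :=
  (List.finite_length_lt Bool N).subset fun u hu => by
    by_contra hc
    exact hu (h u (not_lt.1 hc))

theorem isFGEssential_of_length_le {R : Set Word} (hR : IsRightIdeal R) (N : ℕ)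
    (h : ∀ u : Word, N ≤ u.length → u ∈ R) : IsFGEssential R :=
  isFGEssential_iff.2 ⟨hR, finite_compl_of_length_le N h⟩

/-- A full binary tree has one leaf more than it has inner vertices. -/
theorem ncard_code {R : Set Word} (hR : IsFGEssential R) : (code R).ncard = Rᶜ.ncard + 1 := by
  have hfin := hR.2
  obtain ⟨hid, hc⟩ := isFGEssential_iff.1 hR
  -- Both sides are the vertex set of the tree: leaves and inner vertices on the left; the root and
  -- the children of inner vertices on the right.
  have key : code R ∪ Rᶜ =
      {[]} ∪ ((fun u => u ++ [false]) '' Rᶜ ∪ (fun u => u ++ [true]) '' Rᶜ) := by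
    ext u
    rcases List.eq_nil_or_concat u with rfl | ⟨w, a, rfl⟩
    · simp only [Set.mem_union, Set.mem_compl_iff, Set.mem_singleton_iff, true_or, iff_true]
      by_cases h : [] ∈ R
      · exact Or.inl ⟨h, fun v _ hv => List.prefix_nil.1 hv⟩
      · exact Or.inr h
    · rw [List.concat_eq_append]
      have : (w ++ [a] ∈ code R ∪ Rᶜ) ↔ w ∉ R := by
        constructor
        · rintro (h | h) hw
          · have := h.2 w hw (List.prefix_append _ _)
            simp at this
          · exact h (hid w hw _)
        · intro hw
          by_cases h : w ++ [a] ∈ R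
          · refine Or.inl ⟨h, fun v hv hp => ?_⟩
            rcases List.prefix_concat_iff.1 hp with rfl | hp
            · rfl
            · obtain ⟨y, rfl⟩ := hp
              exact absurd (hid v hv y) hw
          · exact Or.inr h
      rw [this]
      cases a <;> simp
  have d1 : Disjoint (code R) Rᶜ := Set.disjoint_left.2 fun u hu hu' => hu' hu.1
  have e1 := Set.ncard_union_eq d1 hfin hc
  have inj : ∀ b : Bool, Function.Injective (fun u : Word => u ++ [b]) := fun b u v h =>
    List.append_cancel_right h
  have e2 : ((fun u : Word => u ++ [false]) '' Rᶜ ∪ (fun u => u ++ [true]) '' Rᶜ).ncard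
      = Rᶜ.ncard + Rᶜ.ncard := by
    rw [Set.ncard_union_eq ?_ (hc.image _) (hc.image _), Set.ncard_image_of_injective _ (inj _),
      Set.ncard_image_of_injective _ (inj _)]
    refine Set.disjoint_left.2 ?_
    rintro _ ⟨u, _, rfl⟩ ⟨v, _, h⟩
    simp at h
  have e3 : ({[]} ∪ ((fun u : Word => u ++ [false]) '' Rᶜ ∪ (fun u => u ++ [true]) '' Rᶜ)).ncard
      = 1 + (Rᶜ.ncard + Rᶜ.ncard) := by
    rw [Set.ncard_union_eq ?_ (Set.finite_singleton _) ((hc.image _).union (hc.image _)), e2,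
      Set.ncard_singleton]
    simp
  rw [key, e3] at e1
  omega

/-! ### Action of elements on words -/

/-- `g` maps `u x` to `v x` for all words `x`. -/
def Maps (g : V) (u v : Word) : Prop := v ∈ g.toPEquiv u

theorem Maps.append {g : V} {u v : Word} (h : Maps g u v) (x : Word) :
    Maps g (u ++ x) (v ++ x) := g.isFGEssentialIso.iso.map_append _ _ h x

theorem Maps.right_unique {g : V} {u v w : Word} (h : Maps g u v) (h' : Maps g u w) : v = w :=
  Option.mem_unique h h'

theorem Maps.left_unique {g : V} {u v w : Word} (h : Maps g u w) (h' : Maps g v w) : u = v :=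
  g.toPEquiv.inj h h'

theorem Maps.mul {g h : V} {u v w : Word} (hh : Maps h u v) (hg : Maps g v w) :
    Maps (g * h) u w :=
  V.trans_le_mul g h u w ((PEquiv.mem_trans _ _ _ _).2 ⟨v, hh, hg⟩)

theorem maps_one (u : Word) : Maps 1 u u := by
  change u ∈ PEquiv.refl Word u
  simp

theorem maps_inv {g : V} {u v : Word} : Maps g⁻¹ v u ↔ Maps g u v := PEquiv.mem_iff_mem _

/-- A maximal isomorphism is defined wherever it can be. -/
theorem maps_of_forall_length_le {g : V} {u v : Word} (N : ℕ)
    (h : ∀ x : Word, N ≤ x.length → Maps g (u ++ x) (v ++ x)) : Maps g u v := by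
  -- The pairs satisfying the hypothesis for some bound form a right-ideal isomorphism extending
  -- `g`; by maximality it adds nothing.
  obtain ⟨F, hF⟩ := exists_pequiv_of_rel
    (fun u v => ∃ N, ∀ x : Word, N ≤ x.length → Maps g (u ++ x) (v ++ x))
    (by
      rintro u v w ⟨N, hN⟩ ⟨M, hM⟩
      have h1 := hN (List.replicate (N + M) true) (by simp)
      have h2 := hM (List.replicate (N + M) true) (by simp)
      exact List.append_cancel_right (h1.right_unique h2))
    (by
      rintro u v w ⟨N, hN⟩ ⟨M, hM⟩
      have h1 := hN (List.replicate (N + M) true) (by simp)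
      have h2 := hM (List.replicate (N + M) true) (by simp)
      exact List.append_cancel_right (h1.left_unique h2))
  have hiso : IsRightIdealIso F := isRightIdealIso_of_map fun u v h x => by
    rw [hF] at h ⊢
    obtain ⟨N, hN⟩ := h
    refine ⟨N, fun y hy => ?_⟩
    rw [List.append_assoc, List.append_assoc]
    exact hN _ (by rw [List.length_append]; omega)
  exact g.isMaximalIso.2 hiso (fun u v h => (hF u v).2 ⟨0, fun x _ => Maps.append h x⟩) u v
    ((hF u v).2 ⟨N, h⟩)

theorem V.ext_of_maps {g h : V} (N : ℕ)
    (H : ∀ u : Word, N ≤ u.length → ∃ v, Maps g u v ∧ Maps h u v) : g = h := by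
  have key : ∀ g h : V, (∀ u : Word, N ≤ u.length → ∃ v, Maps g u v ∧ Maps h u v) →
      ∀ u v, Maps g u v → Maps h u v := by
    intro g h H u v huv
    refine maps_of_forall_length_le N fun x hx => ?_
    obtain ⟨w, hw, hw'⟩ := H (u ++ x) (by rw [List.length_append]; omega)
    rwa [(huv.append x).right_unique hw]
  refine V.ext (le_antisymm (key g h H) (key h g fun u hu => ?_))
  obtain ⟨v, hv⟩ := H u hu
  exact ⟨v, hv.2, hv.1⟩

theorem exists_maps_of_length_le (g : V) :
    ∃ N, ∀ u : Word, N ≤ u.length → ∃ v, Maps g u v :=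
  exists_length_le_of_finite_compl (isFGEssential_iff.1 g.isFGEssentialIso.dom_fg).2

theorem exists_maps_mul_of_length_le (g h : V) :
    ∃ N, ∀ u : Word, N ≤ u.length → ∃ v w, Maps h u v ∧ Maps g v w := by
  obtain ⟨N, hN⟩ := exists_length_le_of_finite_compl
    (isFGEssential_iff.1 (dom_trans_fg h.isFGEssentialIso g.isFGEssentialIso)).2
  refine ⟨N, fun u hu => ?_⟩
  obtain ⟨w, hw⟩ := hN u hu
  obtain ⟨v, hv, hvw⟩ := (PEquiv.mem_trans _ _ _ _).1 hw
  exact ⟨v, w, hv, hvw⟩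

/-! ### Swap, rotation and copies below a vertex -/

theorem exists_V_of_pequiv (f : Word ≃. Word)
    (hf : ∀ u v : Word, v ∈ f u → ∀ x : Word, v ++ x ∈ f (u ++ x)) (N : ℕ)
    (h1 : ∀ u : Word, N ≤ u.length → ∃ v, v ∈ f u)
    (h2 : ∀ v : Word, N ≤ v.length → ∃ u, v ∈ f u) :
    ∃ g : V, ∀ u v, v ∈ f u → Maps g u v := by
  have hiso := isRightIdealIso_of_map hf
  have hfg : IsFGEssentialIso f := ⟨hiso, isFGEssential_of_length_le hiso.dom_ideal N h1,
    isFGEssential_of_length_le hiso.im_ideal N h2⟩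
  exact ⟨⟨maxExt f hfg, isFGEssentialIso_maxExt _, isMaximalIso_maxExt _⟩, le_maxExt hfg⟩

theorem exists_swap : ∃ g : V, Maps g [false] [true] ∧ Maps g [true] [false] := by
  obtain ⟨g, hg⟩ := exists_V_of_pequiv
    { toFun := fun u => match u with
        | [] => none
        | b :: u => some ((!b) :: u)
      invFun := fun u => match u with
        | [] => none
        | b :: u => some ((!b) :: u)
      inv := by
        rintro (_ | ⟨_ | _, u⟩) (_ | ⟨_ | _, v⟩) <;> simp [eq_comm] }
    (by
      rintro (_ | ⟨b, u⟩) v h x <;> simp at h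
      subst h
      simp) 1
    (by rintro (_ | ⟨b, u⟩) h <;> simp_all)
    (by
      rintro (_ | ⟨b, u⟩) h
      · simp at h
      · exact ⟨(!b) :: u, by simp⟩)
  exact ⟨g, hg _ _ (by simp), hg _ _ (by simp)⟩

theorem exists_assoc : ∃ g : V, Maps g [false] [false, false] ∧
    Maps g [true, false] [false, true] ∧ Maps g [true, true] [true] := by
  obtain ⟨g, hg⟩ := exists_V_of_pequiv
    { toFun := fun u => match u with
        | false :: u => some (false :: false :: u)
        | true :: false :: u => some (false :: true :: u)
        | true :: true :: u => some (true :: u)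
        | _ => none
      invFun := fun u => match u with
        | false :: false :: u => some (false :: u)
        | false :: true :: u => some (true :: false :: u)
        | true :: u => some (true :: true :: u)
        | _ => none
      inv := by
        rintro (_ | ⟨_ | _, (_ | ⟨_ | _, u⟩)⟩) (_ | ⟨_ | _, (_ | ⟨_ | _, v⟩)⟩) <;>
          constructor <;> intro h <;> simp at h ⊢ <;> simp [h] }
    (by
      rintro (_ | ⟨_ | _, (_ | ⟨_ | _, u⟩)⟩) v h x <;> simp at h <;> subst h <;> simp) 2
    (by rintro (_ | ⟨_ | _, (_ | ⟨_ | _, u⟩)⟩) h <;> simp_all)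
    (by
      rintro (_ | ⟨_ | _, (_ | ⟨_ | _, u⟩)⟩) h
      · simp at h
      · simp at h
      · exact ⟨false :: u, by simp⟩
      · exact ⟨true :: false :: u, by simp⟩
      · simp at h
      · exact ⟨true :: true :: false :: u, by simp⟩
      · exact ⟨true :: true :: true :: u, by simp⟩)
  exact ⟨g, hg _ _ (by simp), hg _ _ (by simp), hg _ _ (by simp)⟩

theorem exists_subtree (g : V) : ∃ g' : V, Maps g' [true] [true] ∧
    ∀ u v, Maps g u v → Maps g' (false :: u) (false :: v) := by
  obtain ⟨N, hN⟩ := exists_maps_of_length_le g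
  obtain ⟨M, hM⟩ := exists_maps_of_length_le g⁻¹
  obtain ⟨F, hF⟩ := exists_pequiv_of_rel
    (fun u v => (∃ x, u = true :: x ∧ v = true :: x) ∨
      ∃ x y, u = false :: x ∧ v = false :: y ∧ Maps g x y)
    (by
      rintro _ _ _ (⟨x, rfl, rfl⟩ | ⟨x, y, rfl, rfl, h⟩) (⟨x', h1, rfl⟩ | ⟨x', y', h1, rfl, h'⟩)
      · simp_all
      · simp at h1
      · simp at h1
      · obtain rfl : x = x' := by simpa using h1
        rw [h.right_unique h'])
    (by
      rintro _ _ _ (⟨x, rfl, rfl⟩ | ⟨x, y, rfl, rfl, h⟩) (⟨x', rfl, h1⟩ | ⟨x', y', rfl, h1, h'⟩)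
      · simp_all
      · simp at h1
      · simp at h1
      · obtain rfl : y = y' := by simpa using h1
        rw [h.left_unique h'])
  obtain ⟨g', hg'⟩ := exists_V_of_pequiv F
    (by
      intro u v h z
      rw [hF] at h ⊢
      obtain ⟨x, rfl, rfl⟩ | ⟨x, y, rfl, rfl, h⟩ := h
      · exact Or.inl ⟨x ++ z, rfl, rfl⟩
      · exact Or.inr ⟨x ++ z, y ++ z, rfl, rfl, h.append z⟩)
    (N + M + 1)
    (by
      rintro (_ | ⟨_ | _, u⟩) h
      · simp at h
      · rw [List.length_cons] at h
        obtain ⟨v, hv⟩ := hN u (by omega)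
        exact ⟨_, (hF _ _).2 (Or.inr ⟨u, v, rfl, rfl, hv⟩)⟩
      · exact ⟨_, (hF _ _).2 (Or.inl ⟨u, rfl, rfl⟩)⟩)
    (by
      rintro (_ | ⟨_ | _, u⟩) h
      · simp at h
      · rw [List.length_cons] at h
        obtain ⟨v, hv⟩ := hM u (by omega)
        exact ⟨_, (hF _ _).2 (Or.inr ⟨v, u, rfl, rfl, maps_inv.1 hv⟩)⟩
      · exact ⟨_, (hF _ _).2 (Or.inl ⟨u, rfl, rfl⟩)⟩)
  exact ⟨g', hg' _ _ ((hF _ _).2 (Or.inl ⟨[], rfl, rfl⟩)), fun u v h =>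
    hg' _ _ ((hF _ _).2 (Or.inr ⟨u, v, rfl, rfl, h⟩))⟩

/-- The exchange of the subtrees at `a` and `b`. -/
noncomputable def swap : V := exists_swap.choose

theorem swap_maps_false (u : Word) : Maps swap (false :: u) (true :: u) :=
  exists_swap.choose_spec.1.append u

theorem swap_maps_true (u : Word) : Maps swap (true :: u) (false :: u) :=
  exists_swap.choose_spec.2.append u

/-- The rotation `A (B C) ↦ (A B) C`. -/
noncomputable def assoc : V := exists_assoc.choose

theorem assoc_maps_false (u : Word) : Maps assoc (false :: u) (false :: false :: u) :=
  exists_assoc.choose_spec.1.append u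

theorem assoc_maps_true_false (u : Word) : Maps assoc (true :: false :: u) (false :: true :: u) :=
  exists_assoc.choose_spec.2.1.append u

theorem assoc_maps_true_true (u : Word) : Maps assoc (true :: true :: u) (true :: u) :=
  exists_assoc.choose_spec.2.2.append u

/-- The copy of `g` that acts on the words below `a`. -/
noncomputable def sub (g : V) : V := (exists_subtree g).choose

theorem sub_maps_true (g : V) (u : Word) : Maps (sub g) (true :: u) (true :: u) :=
  (exists_subtree g).choose_spec.1.append u

theorem sub_maps_false {g : V} {u v : Word} (h : Maps g u v) :
    Maps (sub g) (false :: u) (false :: v) :=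
  (exists_subtree g).choose_spec.2 u v h

theorem sub_mul (g h : V) : sub (g * h) = sub g * sub h := by
  obtain ⟨N, hN⟩ := exists_maps_mul_of_length_le g h
  refine V.ext_of_maps (N + 1) ?_
  rintro (_ | ⟨_ | _, u⟩) hu
  · simp at hu
  · obtain ⟨v, w, hv, hw⟩ := hN u (by simpa using hu)
    exact ⟨_, sub_maps_false (hv.mul hw), (sub_maps_false hv).mul (sub_maps_false hw)⟩
  · exact ⟨_, sub_maps_true _ _, (sub_maps_true _ _).mul (sub_maps_true _ _)⟩

theorem sub_one : sub 1 = 1 := by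
  have := sub_mul 1 1
  rwa [mul_one, left_eq_mul] at this

theorem sub_inv (g : V) : sub g⁻¹ = (sub g)⁻¹ := by
  rw [eq_inv_iff_mul_eq_one, ← sub_mul, inv_mul_cancel, sub_one]

/-- The rotation carries the subtree at `a` to the subtree at `aa`, and both sides fix everything
else. This keeps the price of going deeper constant. -/
theorem sub_sub (g : V) : sub (sub g) = assoc * sub g * assoc⁻¹ := by
  obtain ⟨N, hN⟩ := exists_maps_of_length_le g
  refine V.ext_of_maps (N + 2) ?_
  rintro (_ | ⟨_ | _, (_ | ⟨_ | _, u⟩)⟩) hu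
  · simp at hu
  · simp at hu
  · obtain ⟨v, hv⟩ := hN u (by simpa using hu)
    exact ⟨_, sub_maps_false (sub_maps_false hv), (maps_inv.2 (assoc_maps_false u)).mul
      ((sub_maps_false hv).mul (assoc_maps_false v))⟩
  · exact ⟨_, sub_maps_false (sub_maps_true _ _), (maps_inv.2 (assoc_maps_true_false u)).mul
      ((sub_maps_true _ _).mul (assoc_maps_true_false u))⟩
  · simp at hu
  · exact ⟨_, sub_maps_true _ _, (maps_inv.2 (assoc_maps_true_true _)).mul
      ((sub_maps_true _ _).mul (assoc_maps_true_true _))⟩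
  · exact ⟨_, sub_maps_true _ _, (maps_inv.2 (assoc_maps_true_true _)).mul
      ((sub_maps_true _ _).mul (assoc_maps_true_true _))⟩

/-! ### Table sizes -/

theorem tableSize_eq (g : V) : tableSize g = (dom g.toPEquiv)ᶜ.ncard + 1 :=
  ncard_code g.isFGEssentialIso.dom_fg

/-- If `g * h` is undefined at `u`, then either `h` is undefined at `u` or `u` is the preimage under
`h` of a word where `g` is undefined. The default `[]` used for words without a preimage can only
enlarge the covering set. -/
theorem tableSize_mul_le (g h : V) : tableSize (g * h) + 1 ≤ tableSize g + tableSize h := by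
  rw [tableSize_eq, tableSize_eq, tableSize_eq]
  have hg := (isFGEssential_iff.1 g.isFGEssentialIso.dom_fg).2
  have hh := (isFGEssential_iff.1 h.isFGEssentialIso.dom_fg).2
  have key : ((dom (g * h).toPEquiv)ᶜ).ncard ≤
      ((dom h.toPEquiv)ᶜ ∪ (fun v => (h.toPEquiv.symm v).getD []) '' (dom g.toPEquiv)ᶜ).ncard := by
    refine Set.ncard_le_ncard ?_ (hh.union (hg.image _))
    intro u hu
    by_cases hd : u ∈ dom h.toPEquiv
    · right
      obtain ⟨v, hv⟩ := hd
      refine ⟨v, fun ⟨w, hw⟩ => hu ⟨w, Maps.mul (g := g) (h := h) hv hw⟩, ?_⟩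
      have : h.toPEquiv.symm v = some u := (PEquiv.mem_iff_mem _).2 hv
      simp [this]
    · exact Or.inl hd
  have := Set.ncard_union_le (dom h.toPEquiv)ᶜ
    ((fun v => (h.toPEquiv.symm v).getD []) '' (dom g.toPEquiv)ᶜ)
  have := Set.ncard_image_le (f := fun v => (h.toPEquiv.symm v).getD []) hg
  omega

theorem tableSize_one : tableSize 1 = 1 := by
  have : dom (1 : V).toPEquiv = Set.univ := Set.eq_univ_of_forall fun u => ⟨u, maps_one u⟩
  rw [tableSize_eq, this, Set.compl_univ, Set.ncard_empty]

/-! ### Labelled binary trees -/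

/-- Binary trees with labelled leaves. -/
inductive LeafTree (ι : Type) : Type
  | leaf : ι → LeafTree ι
  | node : LeafTree ι → LeafTree ι → LeafTree ι

namespace LeafTree

variable {ι : Type}

/-- The labels of the leaves, from left to right. -/
def labels : LeafTree ι → List ι
  | leaf i => [i]
  | node l r => l.labels ++ r.labels

/-- The number of inner vertices. -/
def inner : LeafTree ι → ℕ
  | leaf _ => 0
  | node l r => l.inner + r.inner + 1

theorem length_labels (T : LeafTree ι) : T.labels.length = T.inner + 1 := by
  induction T with
  | leaf i => rfl
  | node l r hl hr => simp only [labels, inner, List.length_append]; omega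

theorem exists_mem_labels (T : LeafTree ι) : ∃ i, i ∈ T.labels :=
  List.exists_mem_of_length_pos (by rw [length_labels]; omega)

/-- `At T u i`: the tree `T` has a leaf at `u`, with the label `i`. -/
inductive At : LeafTree ι → Word → ι → Prop
  | leaf (i : ι) : At (leaf i) [] i
  | left {l r : LeafTree ι} {u : Word} {i : ι} : At l u i → At (node l r) (false :: u) i
  | right {l r : LeafTree ι} {u : Word} {i : ι} : At r u i → At (node l r) (true :: u) i

theorem mem_labels {T : LeafTree ι} {i : ι} : i ∈ T.labels ↔ ∃ u, At T u i := by
  induction T with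
  | leaf j =>
    simp only [labels, List.mem_singleton]
    constructor
    · rintro rfl
      exact ⟨[], .leaf i⟩
    · rintro ⟨u, h⟩
      cases h
      rfl
  | node l r hl hr =>
    simp only [labels, List.mem_append, hl, hr]
    constructor
    · rintro (⟨u, h⟩ | ⟨u, h⟩)
      · exact ⟨_, .left h⟩
      · exact ⟨_, .right h⟩
    · rintro ⟨u, h⟩
      cases h with
      | left h => exact Or.inl ⟨_, h⟩
      | right h => exact Or.inr ⟨_, h⟩

theorem At.unique {T : LeafTree ι} (hT : T.labels.Nodup) {u v : Word} {i : ι} (hu : At T u i)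
    (hv : At T v i) : u = v := by
  induction T generalizing u v with
  | leaf j => cases hu; cases hv; rfl
  | node l r hl hr =>
    rw [labels, List.nodup_append] at hT
    obtain ⟨h1, h2, h3⟩ := hT
    cases hu with
    | left hu =>
      cases hv with
      | left hv => rw [hl h1 hu hv]
      | right hv => exact absurd rfl (h3 i (mem_labels.2 ⟨_, hu⟩) i (mem_labels.2 ⟨_, hv⟩))
    | right hu =>
      cases hv with
      | left hv => exact absurd rfl (h3 i (mem_labels.2 ⟨_, hv⟩) i (mem_labels.2 ⟨_, hu⟩))
      | right hv => rw [hr h2 hu hv]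

theorem nodup_labels {T : LeafTree ι} (hT : ∀ u v i, At T u i → At T v i → u = v) :
    T.labels.Nodup := by
  induction T with
  | leaf j => simp [labels]
  | node l r hl hr =>
    rw [labels, List.nodup_append]
    refine ⟨hl fun u v i hu hv => ?_, hr fun u v i hu hv => ?_, ?_⟩
    · simpa using hT _ _ _ (.left hu) (.left hv)
    · simpa using hT _ _ _ (.right hu) (.right hv)
    · rintro i hi _ hj rfl
      obtain ⟨u, hu⟩ := mem_labels.1 hi
      obtain ⟨v, hv⟩ := mem_labels.1 hj
      simpa using hT _ _ _ (.left hu) (.right hv)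

/-- One inclusion is enough because the leaves of a full binary tree form a maximal prefix code. -/
theorem ext_of_at {S T : LeafTree ι} (h : ∀ u i, At S u i → At T u i) : S = T := by
  induction S generalizing T with
  | leaf i =>
    cases h _ _ (.leaf i)
    rfl
  | node l r hl hr =>
    cases T with
    | leaf j =>
      obtain ⟨i, hi⟩ := exists_mem_labels l
      obtain ⟨u, hu⟩ := mem_labels.1 hi
      cases h _ _ (.left hu)
    | node l' r' =>
      rw [hl (T := l') fun u i hu => ?_, hr (T := r') fun u i hu => ?_]
      · cases h _ _ (.right hu); assumption
      · cases h _ _ (.left hu); assumption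

theorem exists_prefix_at (T : LeafTree ι) :
    ∃ N, ∀ u : Word, N ≤ u.length → ∃ p i, At T p i ∧ p <+: u := by
  induction T with
  | leaf i => exact ⟨0, fun u _ => ⟨[], i, .leaf i, List.nil_prefix⟩⟩
  | node l r hl hr =>
    obtain ⟨N, hN⟩ := hl
    obtain ⟨M, hM⟩ := hr
    refine ⟨N + M + 1, ?_⟩
    rintro (_ | ⟨_ | _, u⟩) hu
    · simp at hu
    · rw [List.length_cons] at hu
      obtain ⟨p, i, hp, hpu⟩ := hN u (by omega)
      exact ⟨_, i, .left hp, by simpa using hpu⟩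
    · rw [List.length_cons] at hu
      obtain ⟨p, i, hp, hpu⟩ := hM u (by omega)
      exact ⟨_, i, .right hp, by simpa using hpu⟩

end LeafTree

open LeafTree

/-! ### Tables of elements -/

/-- `g` maps the leaves of `S` to the leaves of `T` with the same labels. -/
def Tab {ι : Type} (g : V) (S T : LeafTree ι) : Prop :=
  (∀ u i, At S u i → ∃ v, At T v i ∧ Maps g u v) ∧
    ∀ v i, At T v i → ∃ u, At S u i ∧ Maps g u v

section Tab

variable {ι : Type} {S T U : LeafTree ι} {g h : V}

theorem tab_one (S : LeafTree ι) : Tab 1 S S :=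
  ⟨fun u _ h => ⟨u, h, maps_one u⟩, fun u _ h => ⟨u, h, maps_one u⟩⟩

theorem Tab.mul (hg : Tab g S T) (hh : Tab h T U) : Tab (h * g) S U := by
  constructor
  · intro u i hu
    obtain ⟨v, hv, huv⟩ := hg.1 u i hu
    obtain ⟨w, hw, hvw⟩ := hh.1 v i hv
    exact ⟨w, hw, huv.mul hvw⟩
  · intro w i hw
    obtain ⟨v, hv, hvw⟩ := hh.2 w i hw
    obtain ⟨u, hu, huv⟩ := hg.2 v i hv
    exact ⟨u, hu, huv.mul hvw⟩

theorem Tab.inv (hg : Tab g S T) : Tab g⁻¹ T S := by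
  constructor
  · intro u i hu
    obtain ⟨v, hv, huv⟩ := hg.2 u i hu
    exact ⟨v, hv, maps_inv.2 huv⟩
  · intro u i hu
    obtain ⟨v, hv, huv⟩ := hg.1 u i hu
    exact ⟨v, hv, maps_inv.2 huv⟩

theorem Tab.sub (hg : Tab g S T) (U : LeafTree ι) :
    Tab (sub g) (node S U) (node T U) := by
  constructor
  · intro u i hu
    cases hu with
    | left hu =>
      obtain ⟨v, hv, huv⟩ := hg.1 _ _ hu
      exact ⟨_, .left hv, sub_maps_false huv⟩
    | right hu => exact ⟨_, .right hu, sub_maps_true _ _⟩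
  · intro u i hu
    cases hu with
    | left hu =>
      obtain ⟨v, hv, huv⟩ := hg.2 _ _ hu
      exact ⟨_, .left hv, sub_maps_false huv⟩
    | right hu => exact ⟨_, .right hu, sub_maps_true _ _⟩

theorem tab_swap (S T : LeafTree ι) : Tab swap (node S T) (node T S) := by
  constructor
  · intro u i hu
    cases hu with
    | left hu => exact ⟨_, .right hu, swap_maps_false _⟩
    | right hu => exact ⟨_, .left hu, swap_maps_true _⟩
  · intro u i hu
    cases hu with
    | left hu => exact ⟨_, .right hu, swap_maps_true _⟩
    | right hu => exact ⟨_, .left hu, swap_maps_false _⟩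

theorem tab_assoc (S T U : LeafTree ι) : Tab assoc (node S (node T U)) (node (node S T) U) := by
  constructor
  · intro u i hu
    cases hu with
    | left hu => exact ⟨_, .left (.left hu), assoc_maps_false _⟩
    | right hu =>
      cases hu with
      | left hu => exact ⟨_, .left (.right hu), assoc_maps_true_false _⟩
      | right hu => exact ⟨_, .right hu, assoc_maps_true_true _⟩
  · intro u i hu
    cases hu with
    | left hu =>
      cases hu with
      | left hu => exact ⟨_, .left hu, assoc_maps_false _⟩
      | right hu => exact ⟨_, .right (.left hu), assoc_maps_true_false _⟩
    | right hu => exact ⟨_, .right (.right hu), assoc_maps_true_true _⟩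

/-- Every long word passes through a leaf of `S`, and distinct labels in `T` leave only one target
for that leaf. -/
theorem Tab.unique (hT : T.labels.Nodup) (hg : Tab g S T) (hh : Tab h S T) : g = h := by
  obtain ⟨N, hN⟩ := exists_prefix_at S
  refine V.ext_of_maps N fun u hu => ?_
  obtain ⟨p, i, hp, x, rfl⟩ := hN u hu
  obtain ⟨v, hv, hpv⟩ := hg.1 p i hp
  obtain ⟨w, hw, hpw⟩ := hh.1 p i hp
  obtain rfl := hv.unique hT hw
  exact ⟨_, hpv.append x, hpw.append x⟩

theorem Tab.tree_unique (hg : Tab g S T) (hh : Tab g S U) : T = U := by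
  refine ext_of_at fun v i hv => ?_
  obtain ⟨u, hu, huv⟩ := hg.2 v i hv
  obtain ⟨w, hw, huw⟩ := hh.1 u i hu
  rwa [huv.right_unique huw]

end Tab

/-! ### Cost of rearranging trees -/

/-- Length functions on `V`. -/
structure IsLength (ℓ : V → ℕ) : Prop where
  one : ℓ 1 = 0
  mul_le : ∀ g h, ℓ (g * h) ≤ ℓ g + ℓ h
  inv : ∀ g, ℓ g⁻¹ = ℓ g

/-- `S` can be turned into `T` by an element of length at most `k` whose copy below `a` has
length at most `k`, too. -/
def Cost {ι : Type} (ℓ : V → ℕ) (S T : LeafTree ι) (k : ℕ) : Prop :=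
  S.labels.Perm T.labels ∧ ∃ g, Tab g S T ∧ ℓ g ≤ k ∧ ℓ (sub g) ≤ k

/-- The lengths of the elements used for single steps. -/
noncomputable def stepCost (ℓ : V → ℕ) : ℕ :=
  ℓ swap + ℓ (sub swap) + ℓ assoc + ℓ (sub assoc)

namespace Cost

variable {ι : Type} {ℓ : V → ℕ} {S T U W : LeafTree ι} {k m : ℕ}

theorem mono (h : Cost ℓ S T k) (hkm : k ≤ m) : Cost ℓ S T m := by
  obtain ⟨hp, g, hg, h1, h2⟩ := h
  exact ⟨hp, g, hg, h1.trans hkm, h2.trans hkm⟩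

theorem refl (hℓ : IsLength ℓ) (S : LeafTree ι) : Cost ℓ S S 0 :=
  ⟨List.Perm.refl _, 1, tab_one S, hℓ.one.le, by rw [sub_one, hℓ.one]⟩

theorem trans (hℓ : IsLength ℓ) (h : Cost ℓ S T k) (h' : Cost ℓ T U m) :
    Cost ℓ S U (k + m) := by
  obtain ⟨hp, g, hg, h1, h2⟩ := h
  obtain ⟨hp', g', hg', h1', h2'⟩ := h'
  have e1 := hℓ.mul_le g' g
  have e2 := hℓ.mul_le (sub g') (sub g)
  exact ⟨hp.trans hp', g' * g, hg.mul hg', by omega, by rw [sub_mul]; omega⟩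

theorem symm (hℓ : IsLength ℓ) (h : Cost ℓ S T k) : Cost ℓ T S k := by
  obtain ⟨hp, g, hg, h1, h2⟩ := h
  exact ⟨hp.symm, g⁻¹, hg.inv, by rwa [hℓ.inv], by rwa [sub_inv, hℓ.inv]⟩

theorem swap (S T : LeafTree ι) : Cost ℓ (node S T) (node T S) (stepCost ℓ) :=
  ⟨List.perm_append_comm, Thompson.swap, tab_swap S T, by unfold stepCost; omega,
    by unfold stepCost; omega⟩

theorem assoc (S T U : LeafTree ι) :
    Cost ℓ (node S (node T U)) (node (node S T) U) (stepCost ℓ) :=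
  ⟨by simp [labels], Thompson.assoc, tab_assoc S T U, by unfold stepCost; omega,
    by unfold stepCost; omega⟩

/-- The element used is `sub g`. Its own copy is `sub g` conjugated by the rotation, so both lengths
exceed `k` by at most two rotations. -/
theorem left (hℓ : IsLength ℓ) (h : Cost ℓ S T k) (U : LeafTree ι) :
    Cost ℓ (node S U) (node T U) (k + 2 * stepCost ℓ) := by
  obtain ⟨hp, g, hg, h1, h2⟩ := h
  refine ⟨hp.append_right _, sub g, hg.sub U, by omega, ?_⟩
  rw [sub_sub]
  have e1 := hℓ.mul_le (Thompson.assoc * sub g) Thompson.assoc⁻¹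
  have e2 := hℓ.mul_le Thompson.assoc (sub g)
  rw [hℓ.inv] at e1
  unfold stepCost
  omega

theorem right (hℓ : IsLength ℓ) (h : Cost ℓ S T k) (U : LeafTree ι) :
    Cost ℓ (node U S) (node U T) (k + 4 * stepCost ℓ) :=
  (((swap U S).trans hℓ (h.left hℓ U)).trans hℓ (swap T U)).mono (by omega)

theorem node_node (hℓ : IsLength ℓ) (h : Cost ℓ S T k) (h' : Cost ℓ U W m) :
    Cost ℓ (node S U) (node T W) (k + m + 6 * stepCost ℓ) :=
  ((h.left hℓ U).trans hℓ (h'.right hℓ T)).mono (by omega)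

theorem left_comm (hℓ : IsLength ℓ) (S T U : LeafTree ι) :
    Cost ℓ (node S (node T U)) (node T (node S U)) (7 * stepCost ℓ) :=
  (((swap S (node T U)).trans hℓ ((assoc T U S).symm hℓ)).trans hℓ
    ((swap U S).right hℓ T)).mono (by omega)

theorem right_comm (hℓ : IsLength ℓ) (S T U : LeafTree ι) :
    Cost ℓ (node (node S T) U) (node (node S U) T) (7 * stepCost ℓ) :=
  ((((assoc S T U).symm hℓ).trans hℓ ((swap T U).right hℓ S)).trans hℓ
    (assoc S U T)).mono (by omega)

/-- 13 = 1 + (7 + 4) + 1: rotate back, exchange `T` and `U` inside the right subtree, rotate. -/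
theorem interchange (hℓ : IsLength ℓ) (S T U W : LeafTree ι) :
    Cost ℓ (node (node S T) (node U W)) (node (node S U) (node T W)) (13 * stepCost ℓ) :=
  ((((assoc S T (node U W)).symm hℓ).trans hℓ ((left_comm hℓ T U W).right hℓ S)).trans hℓ
    (assoc S U (node T W))).mono (by omega)

end Cost

/-! ### Divide and conquer -/

section Partition

variable {ι : Type} {ℓ : V → ℕ}

/-- The labels with `c i = false` stand to the left of the root, the others to the right of it,
or all labels have the same colour. -/
def Sorted (c : ι → Bool) (T : LeafTree ι) : Prop :=
  (∃ b, ∀ i ∈ T.labels, c i = b) ∨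
    ∃ A B, T = node A B ∧ (∀ i ∈ A.labels, c i = false) ∧ ∀ i ∈ B.labels, c i = true

/-- Each subtree is of the first colour, of the second, or split, and each of the nine combinations
needs one rearrangement. The dearest is the interchange of two split subtrees. -/
theorem Sorted.node (hℓ : IsLength ℓ) {c : ι → Bool} {S T : LeafTree ι} (hS : Sorted c S)
    (hT : Sorted c T) : ∃ U, Cost ℓ (node S T) U (13 * stepCost ℓ) ∧ Sorted c U := by
  obtain ⟨_ | _, hS⟩ | ⟨A, B, rfl, hA, hB⟩ := hS <;>
    obtain ⟨_ | _, hT⟩ | ⟨A', B', rfl, hA', hB'⟩ := hT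
  · exact ⟨_, (Cost.refl hℓ _).mono (by omega), Or.inl ⟨false, by
      simp only [labels, List.mem_append]; rintro i (h | h) <;> simp_all⟩⟩
  · exact ⟨_, (Cost.refl hℓ _).mono (by omega), Or.inr ⟨S, T, rfl, hS, hT⟩⟩
  · refine ⟨_, (Cost.assoc S A' B').mono (by omega), Or.inr ⟨_, _, rfl, ?_, hB'⟩⟩
    simp only [labels, List.mem_append]; rintro i (h | h) <;> simp_all
  · exact ⟨_, (Cost.swap S T).mono (by omega), Or.inr ⟨_, _, rfl, hT, hS⟩⟩
  · exact ⟨_, (Cost.refl hℓ _).mono (by omega), Or.inl ⟨true, by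
      simp only [labels, List.mem_append]; rintro i (h | h) <;> simp_all⟩⟩
  · refine ⟨_, (Cost.left_comm hℓ S A' B').mono (by omega), Or.inr ⟨_, _, rfl, hA', ?_⟩⟩
    simp only [labels, List.mem_append]; rintro i (h | h) <;> simp_all
  · refine ⟨_, (Cost.right_comm hℓ A B T).mono (by omega), Or.inr ⟨_, _, rfl, ?_, hB⟩⟩
    simp only [labels, List.mem_append]; rintro i (h | h) <;> simp_all
  · refine ⟨_, ((Cost.assoc A B T).symm hℓ).mono (by omega), Or.inr ⟨_, _, rfl, hA, ?_⟩⟩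
    simp only [labels, List.mem_append]; rintro i (h | h) <;> simp_all
  · refine ⟨_, Cost.interchange hℓ A B A' B', Or.inr ⟨_, _, rfl, ?_, ?_⟩⟩ <;>
    simp only [labels, List.mem_append] <;> rintro i (h | h) <;> simp_all

/-- Sort from the leaves up: an inner vertex costs 6 steps for working in its two subtrees and 13
for merging them. -/
theorem exists_sorted (hℓ : IsLength ℓ) (c : ι → Bool) (T : LeafTree ι) :
    ∃ U, Cost ℓ T U (19 * stepCost ℓ * T.inner) ∧ Sorted c U := by
  induction T with
  | leaf i => exact ⟨_, Cost.refl hℓ _, Or.inl ⟨c i, by simp [labels]⟩⟩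
  | node l r hl hr =>
    obtain ⟨l', hl, hl'⟩ := hl
    obtain ⟨r', hr, hr'⟩ := hr
    obtain ⟨U, hU, hU'⟩ := hl'.node hℓ hr'
    refine ⟨U, ((hl.node_node hℓ hr).trans hℓ hU).mono ?_, hU'⟩
    rw [LeafTree.inner]
    ring_nf
    omega

theorem perm_of_append_perm_append {c : ι → Bool} {l₁ l₂ m₁ m₂ : List ι}
    (h : (l₁ ++ l₂).Perm (m₁ ++ m₂)) (hl₁ : ∀ i ∈ l₁, c i = false) (hl₂ : ∀ i ∈ l₂, c i = true)
    (hm₁ : ∀ i ∈ m₁, c i = false) (hm₂ : ∀ i ∈ m₂, c i = true) :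
    l₁.Perm m₁ ∧ l₂.Perm m₂ := by
  have e1 : ∀ l : List ι, (∀ i ∈ l, c i = false) → l.filter c = [] := fun l hl =>
    List.filter_eq_nil_iff.2 fun i hi => by simp [hl i hi]
  have e2 : ∀ l : List ι, (∀ i ∈ l, c i = false) → l.filter (fun i => !c i) = l := fun l hl =>
    List.filter_eq_self.2 fun i hi => by simp [hl i hi]
  have e3 : ∀ l : List ι, (∀ i ∈ l, c i = true) → l.filter c = l := fun l hl =>
    List.filter_eq_self.2 fun i hi => by simp [hl i hi]
  have e4 : ∀ l : List ι, (∀ i ∈ l, c i = true) → l.filter (fun i => !c i) = [] := fun l hl =>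
    List.filter_eq_nil_iff.2 fun i hi => by simp [hl i hi]
  constructor
  · have := h.filter (fun i => !c i)
    rwa [List.filter_append, List.filter_append, e2 _ hl₁, e2 _ hm₁, e4 _ hl₂, e4 _ hm₂,
      List.append_nil, List.append_nil] at this
  · have := h.filter c
    rwa [List.filter_append, List.filter_append, e1 _ hl₁, e1 _ hm₁, e3 _ hl₂, e3 _ hm₂] at this

theorem exists_cost_node (hℓ : IsLength ℓ) {T : LeafTree ι} {l m : List ι}
    (h : T.labels.Perm (l ++ m)) (hl : l ≠ []) (hm : m ≠ []) (hd : (l ++ m).Nodup) :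
    ∃ A B, Cost ℓ T (node A B) (19 * stepCost ℓ * T.inner) ∧ A.labels.Perm l ∧
      B.labels.Perm m := by
  classical
  obtain ⟨i, hi⟩ := List.exists_mem_of_ne_nil l hl
  obtain ⟨j, hj⟩ := List.exists_mem_of_ne_nil m hm
  have hdis := (List.nodup_append.1 hd).2.2
  let c : ι → Bool := fun i => decide (i ∉ l)
  have hcl : ∀ i ∈ l, c i = false := fun i hi => by simpa [c] using hi
  have hcm : ∀ i ∈ m, c i = true := fun i hi => by
    simpa [c] using fun h => hdis i h i hi rfl
  obtain ⟨U, hU, ⟨b, hb⟩ | ⟨A, B, rfl, hA, hB⟩⟩ := exists_sorted hℓ c T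
  · have hp := h.symm.trans hU.1
    have h1 := hb i (hp.subset (List.mem_append_left _ hi))
    have h2 := hb j (hp.subset (List.mem_append_right _ hj))
    rw [hcl i hi] at h1
    rw [hcm j hj, ← h1] at h2
    simp at h2
  · exact ⟨A, B, hU, perm_of_append_perm_append (hU.1.symm.trans h) hA hB hcl hcm⟩

theorem cost_le (hℓ : IsLength ℓ) (n : ℕ) (S T : LeafTree ι) (hd : S.labels.Nodup)
    (hp : S.labels.Perm T.labels) (hn : S.labels.length = n) :
    Cost ℓ S T (44 * stepCost ℓ * (n * Nat.clog 2 n)) := by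
  induction n using Nat.strong_induction_on generalizing S T with
  | _ n ih =>
    by_cases h2 : n < 2
    · have hn' := hn
      have hn'' := hp.length_eq.symm.trans hn
      rw [length_labels] at hn' hn''
      cases S with
      | node l r => rw [LeafTree.inner] at hn'; omega
      | leaf i =>
        cases T with
        | node l r => rw [LeafTree.inner] at hn''; omega
        | leaf j =>
          obtain rfl : i = j := by simpa [labels] using hp
          exact (Cost.refl hℓ _).mono (by omega)
    · have ht : S.labels.take (n / 2) ++ S.labels.drop (n / 2) = S.labels :=
        List.take_append_drop _ _
      have l1 : (S.labels.take (n / 2)).length = n / 2 := by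
        rw [List.length_take]; omega
      have l2 : (S.labels.drop (n / 2)).length = (n + 2 - 1) / 2 := by
        rw [List.length_drop]; omega
      have n1 : S.labels.take (n / 2) ≠ [] := List.ne_nil_of_length_pos (by omega)
      have n2 : S.labels.drop (n / 2) ≠ [] := List.ne_nil_of_length_pos (by omega)
      obtain ⟨A, B, hS, hA, hB⟩ := exists_cost_node hℓ (T := S) (by rw [ht]) n1 n2
        (by rwa [ht])
      -- `T` is split by the halves of the labels of `S`, so that left subtrees match left subtrees
      -- and right match right.
      obtain ⟨A', B', hT, hA', hB'⟩ := exists_cost_node hℓ (T := T) (by rw [ht]; exact hp.symm)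
        n1 n2 (by rwa [ht])
      have iA := ih (n / 2) (by omega) A A' (hA.nodup_iff.2 (hd.sublist (List.take_sublist _ _)))
        (hA.trans hA'.symm) (hA.length_eq.trans l1)
      have iB := ih ((n + 2 - 1) / 2) (by omega) B B'
        (hB.nodup_iff.2 (hd.sublist (List.drop_sublist _ _)))
        (hB.trans hB'.symm) (hB.length_eq.trans l2)
      refine ((hS.trans hℓ (iA.node_node hℓ iB)).trans hℓ (hT.symm hℓ)).mono ?_
      have hc := Nat.clog_of_two_le (b := 2) (n := n) (by omega) (by omega)
      have hc' : Nat.clog 2 (n / 2) ≤ Nat.clog 2 ((n + 2 - 1) / 2) :=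
        Nat.clog_mono_right _ (by omega)
      have hSn : S.inner + 1 = n := by rw [← length_labels, hn]
      have hTn : T.inner + 1 = n := by rw [← length_labels, ← hp.length_eq, hn]
      have hs : n / 2 + (n + 2 - 1) / 2 = n := by omega
      rw [hc]
      generalize Nat.clog 2 ((n + 2 - 1) / 2) = C at *
      generalize Nat.clog 2 (n / 2) = C' at *
      generalize (n + 2 - 1) / 2 = x at *
      generalize n / 2 = y at *
      generalize stepCost ℓ = D
      subst hs
      have hSx : S.inner ≤ y + x := by omega
      have hTx : T.inner ≤ y + x := by omega
      have h6 : 6 * D ≤ 6 * D * (y + x) := Nat.le_mul_of_pos_right _ (by omega)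
      -- One level costs 19 + 6 + 19 = 44 steps per leaf: sort `S`, enter both subtrees, undo the
      -- sorting of `T`.
      calc _ ≤ 19 * D * (y + x) + (44 * D * (y * C) + 44 * D * (x * C) + 6 * D * (y + x)) +
            19 * D * (y + x) := by gcongr
        _ = _ := by ring

end Partition

/-! ### Every element has a table -/

theorem exists_tree_of_isFGEssential {ι : Type} {R : Set Word} (hR : IsFGEssential R)
    (f : Word → ι) :
    ∃ T : LeafTree ι, ∀ u i, At T u i ↔ u ∈ code R ∧ i = f u := by
  induction h : Rᶜ.ncard using Nat.strong_induction_on generalizing R f with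
  | _ n ih =>
    obtain ⟨hid, hc⟩ := isFGEssential_iff.1 hR
    by_cases hnil : [] ∈ R
    · refine ⟨leaf (f []), fun u i => ?_⟩
      constructor
      · intro h
        cases h
        exact ⟨⟨hnil, fun v _ hv => List.prefix_nil.1 hv⟩, rfl⟩
      · rintro ⟨hu, rfl⟩
        obtain rfl := hu.2 [] hnil List.nil_prefix
        exact .leaf _
    -- The part of `R` below a letter misses fewer words than `R`, since the empty word is also
    -- missing from `R`.
    · have step : ∀ b : Bool, ∃ T : LeafTree ι, ∀ u i,
          At T u i ↔ b :: u ∈ code R ∧ i = f (b :: u) := by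
        intro b
        have hinj : Function.Injective (fun u : Word => b :: u) := List.cons_injective
        have hsub : (fun u : Word => b :: u) '' {u : Word | b :: u ∈ R}ᶜ ⊆ Rᶜ \ {[]} := by
          rintro _ ⟨u, hu, rfl⟩
          exact ⟨hu, by simp⟩
        have hfin : ({u : Word | b :: u ∈ R}ᶜ).Finite :=
          Set.Finite.of_finite_image (hc.sdiff.subset hsub) hinj.injOn
        have hlt : ({u : Word | b :: u ∈ R}ᶜ).ncard < n := by
          rw [← Set.ncard_image_of_injective _ hinj, ← h]
          exact (Set.ncard_le_ncard hsub hc.sdiff).trans_lt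
            (Set.ncard_sdiff_singleton_lt_of_mem hnil hc)
        obtain ⟨T, hT⟩ := ih _ hlt
          (isFGEssential_iff.2 ⟨fun u hu x => hid (b :: u) hu x, hfin⟩) (fun u => f (b :: u)) rfl
        refine ⟨T, fun u i => ?_⟩
        rw [hT]
        refine and_congr_left fun _ => ⟨fun hu => ⟨hu.1, ?_⟩, fun hu => ⟨hu.1, ?_⟩⟩
        · rintro (_ | ⟨b', v⟩) hv hp
          · exact absurd hv hnil
          · obtain ⟨rfl, hp'⟩ := List.cons_prefix_cons.1 hp
            rw [hu.2 v hv hp']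
        · intro v hv hp
          exact List.cons_injective (hu.2 (b :: v) hv (List.cons_prefix_cons.2 ⟨rfl, hp⟩))
      obtain ⟨l, hl⟩ := step false
      obtain ⟨r, hr⟩ := step true
      refine ⟨node l r, ?_⟩
      rintro (_ | ⟨_ | _, u⟩) i
      · exact ⟨nofun, fun h => absurd h.1.1 hnil⟩
      · rw [← hl]
        exact ⟨fun h => by cases h; assumption, .left⟩
      · rw [← hr]
        exact ⟨fun h => by cases h; assumption, .right⟩

/-- Every element of `V` has a table with `tableSize g` rows. -/
theorem exists_tab (g : V) : ∃ S T : LeafTree Word, Tab g S T ∧ S.labels.Nodup ∧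
    S.labels.Perm T.labels ∧ S.labels.length = tableSize g := by
  obtain ⟨S, hS⟩ := exists_tree_of_isFGEssential g.isFGEssentialIso.dom_fg id
  -- A leaf of `S` is its own label and a leaf of `T` is labelled by its preimage; the default `[]`
  -- is never used on the image code.
  obtain ⟨T, hT⟩ := exists_tree_of_isFGEssential g.isFGEssentialIso.im_fg
    (fun v => (g.toPEquiv.symm v).getD [])
  have hinv : ∀ u v, Maps g u v → (g.toPEquiv.symm v).getD [] = u := by
    intro u v h
    have : g.toPEquiv.symm v = some u := (PEquiv.mem_iff_mem _).2 h
    simp [this]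
  have code1 : ∀ (g : V) u v, Maps g u v → u ∈ code (dom g.toPEquiv) →
      v ∈ code (im g.toPEquiv) := by
    rintro g u v h ⟨_, hu⟩
    refine ⟨⟨u, h⟩, ?_⟩
    rintro w ⟨p, hp⟩ ⟨x, rfl⟩
    have hpu : p ++ x = u := (Maps.append (g := g) hp x).left_unique h
    have := hu p ⟨w, hp⟩ ⟨x, hpu⟩
    rw [this, List.append_right_eq_self] at hpu
    simp [hpu]
  have code2 : ∀ u v, Maps g u v → v ∈ code (im g.toPEquiv) → u ∈ code (dom g.toPEquiv) := by
    intro u v h hv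
    have := code1 g⁻¹ v u (maps_inv.2 h)
      (by change v ∈ code (dom g.toPEquiv.symm); rwa [dom_symm])
    change u ∈ code (im g.toPEquiv.symm) at this
    rwa [im_symm] at this
  have hST : Tab g S T := by
    constructor
    · intro u i hu
      obtain ⟨hu', hi⟩ := (hS u i).1 hu
      obtain ⟨v, hv⟩ := hu'.1
      exact ⟨v, (hT _ _).2 ⟨code1 g u v hv hu', hi.trans (hinv u v hv).symm⟩, hv⟩
    · intro v i hv
      obtain ⟨hv', rfl⟩ := (hT v i).1 hv
      obtain ⟨u, hu⟩ := hv'.1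
      exact ⟨u, (hS _ _).2 ⟨code2 u v hu hv', hinv u v hu⟩, hu⟩
  have hSd : S.labels.Nodup := nodup_labels fun u v i hu hv =>
    ((hS _ _).1 hu).2.symm.trans ((hS _ _).1 hv).2
  have hTd : T.labels.Nodup := nodup_labels fun u v i hu hv => by
    obtain ⟨p, hp, hpu⟩ := hST.2 u i hu
    obtain ⟨q, hq, hqv⟩ := hST.2 v i hv
    obtain rfl := hp.unique hSd hq
    exact hpu.right_unique hqv
  refine ⟨S, T, hST, hSd, (List.perm_ext_iff_of_nodup hSd hTd).2 fun i => ?_, ?_⟩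
  · rw [mem_labels, mem_labels]
    constructor
    · rintro ⟨u, hu⟩
      obtain ⟨v, hv, _⟩ := hST.1 u i hu
      exact ⟨v, hv⟩
    · rintro ⟨v, hv⟩
      obtain ⟨u, hu, _⟩ := hST.2 v i hv
      exact ⟨u, hu⟩
  · classical
    rw [tableSize, ← List.toFinset_card_of_nodup hSd, ← Set.ncard_coe_finset]
    congr 1
    ext i
    rw [Finset.mem_coe, List.mem_toFinset, mem_labels]
    constructor
    · rintro ⟨u, hu⟩
      obtain ⟨h, rfl⟩ := (hS _ _).1 hu
      exact h
    · intro h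
      exact ⟨i, (hS _ _).2 ⟨h, rfl⟩⟩

theorem length_le {ℓ : V → ℕ} (hℓ : IsLength ℓ) (g : V) :
    ℓ g ≤ 44 * stepCost ℓ * (tableSize g * Nat.clog 2 (tableSize g)) := by
  obtain ⟨S, T, hg, hd, hp, hn⟩ := exists_tab g
  obtain ⟨_, h, hh, hl, _⟩ := cost_le hℓ _ S T hd hp hn
  obtain rfl := hg.unique (hp.nodup_iff.1 hd) hh
  exact hl

/-- For the zero length function the cost bound becomes a pure existence statement. -/
theorem exists_tab_of_perm {ι : Type} {S T : LeafTree ι} (hd : S.labels.Nodup)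
    (hp : S.labels.Perm T.labels) : ∃ g, Tab g S T := by
  obtain ⟨_, g, hg, _⟩ := cost_le (ℓ := fun _ => 0) ⟨rfl, fun _ _ => le_rfl, fun _ => rfl⟩ _ S T
    hd hp rfl
  exact ⟨g, hg⟩

/-! ### Word length and its balls -/

section WordLength

variable {Δ : Finset V}

/-- Generation makes the set under `sInf` nonempty, so its infimum is attained and is not the
default 0. -/
theorem exists_word (hΔ : Subgroup.closure (Δ : Set V) = ⊤) (g : V) :
    ∃ l : List V, (∀ s ∈ l, s ∈ Δ ∨ s⁻¹ ∈ Δ) ∧ l.prod = g ∧ l.length = wordLength Δ g := by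
  refine Nat.sInf_mem (s := {n : ℕ | ∃ l : List V, (∀ s ∈ l, s ∈ Δ ∨ s⁻¹ ∈ Δ) ∧
    l.prod = g ∧ l.length = n}) ?_
  have h : g ∈ (Subgroup.closure (Δ : Set V)).toSubmonoid := by rw [hΔ]; trivial
  rw [Subgroup.closure_toSubmonoid] at h
  obtain ⟨l, hl, hg⟩ := Submonoid.exists_list_of_mem_closure h
  exact ⟨_, l, hl, hg, rfl⟩

theorem wordLength_prod_le {l : List V} (hl : ∀ s ∈ l, s ∈ Δ ∨ s⁻¹ ∈ Δ) :
    wordLength Δ l.prod ≤ l.length :=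
  Nat.sInf_le ⟨l, hl, rfl, rfl⟩

theorem isLength_wordLength (hΔ : Subgroup.closure (Δ : Set V) = ⊤) :
    IsLength (wordLength Δ) where
  one := Nat.le_zero.1 (wordLength_prod_le (l := []) (by simp))
  mul_le g h := by
    obtain ⟨l, hl, hg, hlen⟩ := exists_word hΔ g
    obtain ⟨m, hm, hh, hmen⟩ := exists_word hΔ h
    rw [← hlen, ← hmen, ← List.length_append, ← hg, ← hh, ← List.prod_append]
    refine wordLength_prod_le fun s hs => ?_
    rcases List.mem_append.1 hs with hs | hs
    · exact hl s hs
    · exact hm s hs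
  inv := by
    have key : ∀ g, wordLength Δ g⁻¹ ≤ wordLength Δ g := by
      intro g
      obtain ⟨l, hl, hg, hlen⟩ := exists_word hΔ g
      have e : g⁻¹ = ((l.map (·⁻¹)).reverse).prod := by rw [← hg, List.prod_inv_reverse]
      rw [e, ← hlen]
      refine (wordLength_prod_le fun s hs => ?_).trans (by simp)
      rw [List.mem_reverse, List.mem_map] at hs
      obtain ⟨t, ht, rfl⟩ := hs
      rw [inv_inv]
      exact (hl t ht).symm
    intro g
    refine le_antisymm (key g) ?_
    conv_lhs => rw [← inv_inv g]
    exact key _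

theorem eq_one_of_wordLength_eq_zero (hΔ : Subgroup.closure (Δ : Set V) = ⊤) {g : V}
    (h : wordLength Δ g = 0) : g = 1 := by
  obtain ⟨l, _, hg, hlen⟩ := exists_word hΔ g
  rw [h, List.length_eq_zero_iff] at hlen
  rw [← hg, hlen, List.prod_nil]

theorem tableSize_prod_le {M : ℕ} {l : List V} (hl : ∀ s ∈ l, tableSize s ≤ M) :
    tableSize l.prod ≤ l.length * M + 1 := by
  induction l with
  | nil => simp [tableSize_one]
  | cons s l ih =>
    have h1 := ih fun t ht => hl t (List.mem_cons_of_mem _ ht)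
    have h2 := hl s List.mem_cons_self
    have h3 := tableSize_mul_le s l.prod
    rw [List.prod_cons, List.length_cons, add_mul]
    omega

theorem exists_tableSize_le_mul_wordLength (hΔ : Subgroup.closure (Δ : Set V) = ⊤) :
    ∃ M : ℕ, 0 < M ∧ ∀ g : V, g ≠ 1 → tableSize g ≤ M * wordLength Δ g := by
  let M := ∑ s ∈ Δ, (tableSize s + tableSize s⁻¹)
  have hM : ∀ s ∈ Δ, tableSize s + tableSize s⁻¹ ≤ M := fun s hs =>
    Finset.single_le_sum (f := fun s => tableSize s + tableSize s⁻¹) (fun _ _ => Nat.zero_le _) hs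
  refine ⟨M + 1, by omega, fun g hg => ?_⟩
  obtain ⟨l, hl, hgl, hlen⟩ := exists_word hΔ g
  have h1 : tableSize l.prod ≤ l.length * M + 1 := by
    refine tableSize_prod_le fun s hs => ?_
    rcases hl s hs with h | h
    · have := hM s h; omega
    · have := hM _ h; rw [inv_inv] at this; omega
  have h2 : wordLength Δ g ≠ 0 := fun h => hg (eq_one_of_wordLength_eq_zero hΔ h)
  rw [hgl, hlen] at h1
  rw [add_mul, mul_comm M]
  -- The summand 1 in `h1` is absorbed by one of the factors, as the length is positive; hence the
  -- constant `M + 1`.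
  omega

theorem one_le_card_of_closure_eq_top (hΔ : Subgroup.closure (Δ : Set V) = ⊤) : 1 ≤ Δ.card := by
  rw [Finset.one_le_card]
  by_contra h
  rw [Finset.not_nonempty_iff_eq_empty] at h
  rw [h, Finset.coe_empty, Subgroup.closure_empty] at hΔ
  have : swap ∈ (⊥ : Subgroup V) := by rw [hΔ]; trivial
  rw [Subgroup.mem_bot] at this
  have h1 := swap_maps_false []
  rw [this] at h1
  simpa using h1.right_unique (maps_one _)

open scoped Pointwise in
/-- Balls of the word length are finite and grow at most exponentially. -/
theorem ball_finite_and_ncard_le (hΔ : Subgroup.closure (Δ : Set V) = ⊤) (k : ℕ) :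
    {g : V | wordLength Δ g ≤ k}.Finite ∧
      {g : V | wordLength Δ g ≤ k}.ncard ≤ (2 * Δ.card) ^ (k + 1) := by
  classical
  have h1 := one_le_card_of_closure_eq_top hΔ
  let S : Finset V := Δ ∪ Δ⁻¹
  have hS : S.card ≤ 2 * Δ.card := (Finset.card_union_le _ _).trans (by
    rw [Finset.card_inv]; omega)
  have hprod : ∀ l : List V, (∀ s ∈ l, s ∈ Δ ∨ s⁻¹ ∈ Δ) → l.prod ∈ S ^ l.length := by
    intro l hl
    induction l with
    | nil => simp
    | cons s l ih =>
      rw [List.prod_cons, List.length_cons, pow_succ']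
      refine Finset.mul_mem_mul ?_ (ih fun t ht => hl t (List.mem_cons_of_mem _ ht))
      simpa [S] using hl s List.mem_cons_self
  have hsub : {g : V | wordLength Δ g ≤ k} ⊆
      ((Finset.range (k + 1)).biUnion fun i => S ^ i : Finset V) := by
    intro g hg
    obtain ⟨l, hl, hgl, hlen⟩ := exists_word hΔ g
    rw [Finset.mem_coe, Finset.mem_biUnion]
    refine ⟨wordLength Δ g, Finset.mem_range.2 (Nat.lt_succ_of_le hg), ?_⟩
    rw [← hlen]
    exact hgl ▸ hprod l hl
  refine ⟨(Finset.finite_toSet _).subset hsub, ?_⟩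
  calc _ ≤ _ := Set.ncard_le_ncard hsub (Finset.finite_toSet _)
    _ = _ := Set.ncard_coe_finset _
    _ ≤ ∑ i ∈ Finset.range (k + 1), (S ^ i).card := Finset.card_biUnion_le
    _ ≤ ∑ i ∈ Finset.range (k + 1), (2 * Δ.card) ^ i := Finset.sum_le_sum fun i _ =>
        Finset.card_pow_le.trans (Nat.pow_le_pow_left hS i)
    _ ≤ _ := (Nat.geomSum_lt (by omega) fun i hi => Finset.mem_range.1 hi).le

/-- The upper bound on the word length places all these elements in one ball. -/
theorem finite_tableSize_eq (n : ℕ) (hΔ : Subgroup.closure (Δ : Set V) = ⊤) :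
    {g : V | tableSize g = n}.Finite :=
  (ball_finite_and_ncard_le hΔ _).1.subset fun g (hg : tableSize g = n) => by
    have := length_le (isLength_wordLength hΔ) g
    rwa [hg] at this

end WordLength

/-! ### Counting elements of a given table size -/

namespace LeafTree

variable {ι : Type}

/-- The tree with the leaves `a, ba, bba, …` and one last leaf `b…b`. -/
def comb : List ι → ι → LeafTree ι
  | [], z => leaf z
  | i :: l, z => node (leaf i) (comb l z)

theorem labels_comb (l : List ι) (z : ι) : (comb l z).labels = l ++ [z] := by
  induction l with
  | nil => rfl
  | cons i l ih => simp [comb, labels, ih]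

theorem at_comb (l : List ι) (z : ι) : At (comb l z) (List.replicate l.length true) z := by
  induction l with
  | nil => exact .leaf z
  | cons i l ih => exact .right ih

theorem comb_cases (l : List ι) (z : ι) (u : Word) :
    (∃ j < l.length, u = List.replicate j true) ∨ ∃ p i, At (comb l z) p i ∧ p <+: u := by
  induction l generalizing u with
  | nil => exact Or.inr ⟨[], z, .leaf z, List.nil_prefix⟩
  | cons i l ih =>
    rcases u with _ | ⟨_ | _, u⟩
    · exact Or.inl ⟨0, by simp, rfl⟩
    · exact Or.inr ⟨[false], i, .left (.leaf i), u, rfl⟩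
    · rcases ih u with ⟨j, hj, rfl⟩ | ⟨p, k, hp, hpu⟩
      · exact Or.inl ⟨j + 1, by simpa using hj, rfl⟩
      · exact Or.inr ⟨true :: p, k, .right hp, List.cons_prefix_cons.2 ⟨rfl, hpu⟩⟩

theorem exists_first_leaf (T : LeafTree ι) :
    ∃ k i l, At T (List.replicate k false) i ∧ T.labels = i :: l := by
  induction T with
  | leaf i => exact ⟨0, i, [], .leaf i, rfl⟩
  | node l r hl _ =>
    obtain ⟨k, i, m, hk, hm⟩ := hl
    exact ⟨k + 1, i, m ++ r.labels, .left hk, by rw [labels, hm]; rfl⟩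

/-- The underlying tree of a labelled tree. -/
def shape : LeafTree ι → BinaryTree Unit
  | leaf _ => .nil
  | node l r => .node () l.shape r.shape

/-- The tree of the given shape whose leaves get the given labels from left to right. -/
def fill : BinaryTree Unit → List ℕ → LeafTree ℕ
  | .nil, l => leaf (l.headD 0)
  | .node _ s t, l => node (fill s (l.take (s.numNodes + 1))) (fill t (l.drop (s.numNodes + 1)))

theorem shape_fill (t : BinaryTree Unit) (l : List ℕ) : (fill t l).shape = t := by
  induction t generalizing l with
  | nil => rfl
  | node _ s t hs ht => simp [fill, shape, hs, ht]

theorem labels_fill (t : BinaryTree Unit) (l : List ℕ) (h : l.length = t.numNodes + 1) :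
    (fill t l).labels = l := by
  induction t generalizing l with
  | nil =>
    obtain ⟨i, rfl⟩ := List.length_eq_one_iff.1 h
    rfl
  | node _ s t hs ht =>
    rw [BinaryTree.numNodes] at h
    rw [fill, labels, hs _ (by rw [List.length_take]; omega),
      ht _ (by rw [List.length_drop]; omega), List.take_append_drop]

end LeafTree

/-- The common label `z` makes `g` send the last leaf `b…b` of the comb to the first leaf `a…a` of
`T`. Were `g` defined at a shorter power of `b`, the image `a…a` would end in `b`. So the comb is
already the tree of the maximal domain. -/
theorem tableSize_of_tab_comb {ι : Type} {g : V} {l m : List ι} {z : ι} {T : LeafTree ι}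
    (hg : Tab g (comb l z) T) (hd : T.labels.Nodup) (hT : T.labels = z :: m) :
    tableSize g = l.length + 1 := by
  obtain ⟨k, i, m', hk, hm'⟩ := exists_first_leaf T
  obtain ⟨rfl, rfl⟩ := List.cons.inj (hT.symm.trans hm')
  obtain ⟨v, hv, hmaps⟩ := hg.1 _ _ (at_comb l z)
  obtain rfl := hv.unique hd hk
  have : (dom g.toPEquiv)ᶜ = (fun j => List.replicate j true) '' Set.Iio l.length := by
    ext u
    constructor
    · intro hu
      rcases comb_cases l z u with ⟨j, hj, rfl⟩ | ⟨p, i, hp, x, rfl⟩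
      · exact ⟨j, hj, rfl⟩
      · obtain ⟨v, _, hpv⟩ := hg.1 p i hp
        exact absurd ⟨_, hpv.append x⟩ hu
    · rintro ⟨j, hj, rfl⟩ ⟨v, hv⟩
      have h1 := Maps.append (g := g) hv (List.replicate (l.length - j) true)
      rw [List.replicate_append_replicate, Nat.add_sub_cancel' (le_of_lt hj)] at h1
      have h2 : true ∈ List.replicate k false := by
        rw [hmaps.right_unique h1]
        exact List.mem_append_right _ (List.mem_replicate.2 ⟨Nat.sub_ne_zero_of_lt hj, rfl⟩)
      simp [List.mem_replicate] at h2
  rw [tableSize_eq, this, Set.ncard_image_of_injective _ fun i j h => by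
    simpa using congrArg List.length h, ← Finset.coe_Iio, Set.ncard_coe_finset, Nat.card_Iio]

/-- There are many elements of a given table size. -/
theorem catalan_mul_factorial_le_ncard {m : ℕ} (hfin : {g : V | tableSize g = m + 1}.Finite) :
    catalan m * m.factorial ≤ {g : V | tableSize g = m + 1}.ncard := by
  classical
  let P : Finset (BinaryTree Unit × List ℕ) :=
    -- The target tree has any shape with m + 1 leaves; label m is forced onto its first leaf and
    -- the other m labels are free.
    BinaryTree.treesOfNumNodesEq m ×ˢ (List.range m).permutations.toFinset
  have hP : P.card = catalan m * m.factorial := by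
    rw [Finset.card_product, BinaryTree.treesOfNumNodesEq_card_eq_catalan,
      List.toFinset_card_of_nodup (List.nodup_permutations _ List.nodup_range),
      List.length_permutations, List.length_range]
  have hnd : (List.range m ++ [m]).Nodup := by
    rw [← List.range_succ]; exact List.nodup_range
  have key : ∀ x : BinaryTree Unit × List ℕ, ∃ g : V, x ∈ P →
      (fill x.1 (m :: x.2)).labels = m :: x.2 ∧ tableSize g = m + 1 ∧
        Tab g (comb (List.range m) m) (fill x.1 (m :: x.2)) := by
    intro x
    by_cases hx : x ∈ P
    · obtain ⟨h1, h2⟩ := Finset.mem_product.1 hx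
      rw [BinaryTree.mem_treesOfNumNodesEq] at h1
      rw [List.mem_toFinset, List.mem_permutations] at h2
      have hl : (fill x.1 (m :: x.2)).labels = m :: x.2 :=
        labels_fill _ _ (by rw [List.length_cons, h2.length_eq, List.length_range, h1])
      have hp : (comb (List.range m) m).labels.Perm (fill x.1 (m :: x.2)).labels := by
        rw [hl, labels_comb]
        exact (List.perm_append_singleton _ _).trans (h2.symm.cons _)
      have hd : (comb (List.range m) m).labels.Nodup := by rwa [labels_comb]
      obtain ⟨g, hg⟩ := exists_tab_of_perm hd hp
      refine ⟨g, fun _ => ⟨hl, ?_, hg⟩⟩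
      rw [tableSize_of_tab_comb hg (hp.nodup_iff.1 hd) hl, List.length_range]
    · exact ⟨1, fun h => absurd h hx⟩
  choose F hF using key
  rw [← hP, ← Set.ncard_coe_finset]
  refine Set.ncard_le_ncard_of_injOn F (fun x hx => (hF x hx).2.1) ?_ hfin
  intro x hx y hy hxy
  obtain ⟨hx1, _, hx2⟩ := hF x hx
  obtain ⟨hy1, _, hy2⟩ := hF y hy
  rw [hxy] at hx2
  have e := hx2.tree_unique hy2
  refine Prod.ext ?_ ?_
  · rw [← shape_fill x.1 (m :: x.2), e, shape_fill]
  · rw [e, hy1] at hx1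
    exact (List.cons.inj hx1).2.symm

/-! ### Numerical estimates -/

theorem four_pow_le_centralBinom (m : ℕ) : 4 ^ (m + 1) ≤ 8 * (m + 1) * Nat.centralBinom m := by
  rcases Nat.eq_zero_or_pos m with rfl | hm
  · simp
  · have := Nat.four_pow_le_two_mul_self_mul_centralBinom m hm
    calc 4 ^ (m + 1) = 4 * 4 ^ m := by ring
      _ ≤ 4 * (2 * m * Nat.centralBinom m) := by gcongr
      _ = 8 * m * Nat.centralBinom m := by ring
      _ ≤ _ := by gcongr; omega

/-- With n = m + 1, this multiplies n^n ≤ e^n n! by the central binomial bound. The cube collects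
one n from n! = n m!, one from the binomial coefficient n `catalan m`, and one from the bound
itself. -/
theorem pow_self_mul_four_pow_le (m : ℕ) :
    ((m + 1 : ℕ) : ℝ) ^ (m + 1) * 4 ^ (m + 1) ≤
      8 * ((m + 1 : ℕ) : ℝ) ^ 3 * Real.exp 1 ^ (m + 1) *
        ((catalan m * m.factorial : ℕ) : ℝ) := by
  have h1 := Real.pow_div_factorial_le_exp (x := ((m + 1 : ℕ) : ℝ)) (by positivity) (m + 1)
  rw [div_le_iff₀ (by positivity), ← mul_one ((m + 1 : ℕ) : ℝ), Real.exp_nat_mul, mul_one,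
    Nat.factorial_succ] at h1
  have h2 : (4 : ℝ) ^ (m + 1) ≤ 8 * ((m + 1 : ℕ) : ℝ) * (((m + 1) * catalan m : ℕ) : ℝ) := by
    rw [succ_mul_catalan_eq_centralBinom]
    exact_mod_cast four_pow_le_centralBinom m
  calc _ ≤ (Real.exp 1 ^ (m + 1) * (((m + 1) * m.factorial : ℕ) : ℝ)) *
        (8 * ((m + 1 : ℕ) : ℝ) * (((m + 1) * catalan m : ℕ) : ℝ)) := by gcongr
    _ = _ := by push_cast; ring

theorem exists_pow_three_mul_pow_le :
    ∃ B : ℝ, 0 < B ∧ ∀ n : ℕ, (n : ℝ) ^ 3 * (Real.exp 1 / 3) ^ n ≤ B := by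
  have h3 : |Real.exp 1 / 3| < 1 := by
    rw [abs_of_pos (by positivity), div_lt_one (by norm_num)]
    exact Real.exp_one_lt_three
  obtain ⟨B, hB⟩ := (tendsto_pow_const_mul_const_pow_of_abs_lt_one 3 h3).bddAbove_range
  exact ⟨max B 1, by positivity, fun n => (hB ⟨n, rfl⟩).trans (le_max_left _ _)⟩

theorem clog_le_two_mul_logb {n : ℕ} (hn : 2 ≤ n) :
    (Nat.clog 2 n : ℝ) ≤ 2 * Real.logb 2 n := by
  have h1 : 1 ≤ Real.logb 2 n := by
    rw [Real.le_logb_iff_rpow_le (by norm_num) (by positivity), Real.rpow_one]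
    exact_mod_cast hn
  have h2 := Nat.ceil_lt_add_one (zero_le_one.trans h1)
  have h3 := Real.natCeil_logb_natCast 2 n
  rw [Nat.cast_ofNat] at h3
  rw [h3] at h2
  linarith

theorem ncard_wordLength_le_mul_logb {Δ : Finset V}
    (hΔ : Subgroup.closure (Δ : Set V) = ⊤) {n : ℕ} (hn : 1 ≤ n) :
    {g : V | (wordLength Δ g : ℝ) ≤ n * Real.logb (2 * Δ.card) n}.Finite ∧
    ({g : V | (wordLength Δ g : ℝ) ≤ n * Real.logb (2 * Δ.card) n}.ncard : ℝ) ≤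
      2 * Δ.card * (n : ℝ) ^ n := by
  have hd : (1 : ℝ) ≤ Δ.card := by exact_mod_cast one_le_card_of_closure_eq_top hΔ
  have hn' : (1 : ℝ) ≤ n := by exact_mod_cast hn
  set x : ℝ := n * Real.logb (2 * Δ.card) n
  have hx : 0 ≤ x := mul_nonneg (by linarith) (Real.logb_nonneg (by linarith) hn')
  have hset : {g : V | (wordLength Δ g : ℝ) ≤ x} = {g : V | wordLength Δ g ≤ ⌊x⌋₊} := by
    ext g
    exact (Nat.le_floor_iff hx).symm
  obtain ⟨h1, h2⟩ := ball_finite_and_ncard_le hΔ ⌊x⌋₊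
  rw [hset]
  refine ⟨h1, ?_⟩
  -- The base 2|Δ| bounds the number of letters, so the ball of radius `x` is governed by exactly
  -- n^n.
  have h3 : (2 * (Δ.card : ℝ)) ^ x = (n : ℝ) ^ n := by
    rw [show x = Real.logb (2 * Δ.card) n * n from mul_comm _ _,
      Real.rpow_mul (by linarith), Real.rpow_logb (by linarith) (by linarith) (by linarith),
      Real.rpow_natCast]
  calc _ ≤ (((2 * Δ.card) ^ (⌊x⌋₊ + 1) : ℕ) : ℝ) := by exact_mod_cast h2
    _ = 2 * Δ.card * (2 * (Δ.card : ℝ)) ^ (⌊x⌋₊ : ℝ) := by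
      rw [Real.rpow_natCast]; push_cast; ring
    _ ≤ 2 * Δ.card * (2 * (Δ.card : ℝ)) ^ x := by
      refine mul_le_mul_of_nonneg_left ?_ (by linarith)
      exact Real.rpow_le_rpow_of_exponent_le (by linarith) (Nat.floor_le hx)
    _ = _ := by rw [h3]

theorem catalan_pos (m : ℕ) : 0 < catalan m := by
  refine Nat.pos_of_mul_pos_left (a := m + 1) ?_
  rw [succ_mul_catalan_eq_centralBinom]
  exact Nat.centralBinom_pos m

/-! ### The bounds of the theorem -/

theorem wordLength_bounds {Δ : Finset V}
    (hΔ : Subgroup.closure (Δ : Set V) = ⊤) :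
    ∃ c c' : ℝ, 0 < c ∧ 0 < c' ∧ ∀ g : V, g ≠ 1 →
      c' * (tableSize g : ℝ) ≤ (wordLength Δ g : ℝ) ∧
      (wordLength Δ g : ℝ) ≤ c * ((tableSize g : ℝ) * Real.logb 2 (tableSize g : ℝ)) := by
  have hℓ := isLength_wordLength hΔ
  obtain ⟨M, hM, hlow⟩ := exists_tableSize_le_mul_wordLength hΔ
  have hM' : (0 : ℝ) < M := by exact_mod_cast hM
  -- The factor 2 pays for replacing `Nat.clog` by the real logarithm; the summand 1 only ensures
  -- positivity.
  refine ⟨2 * (44 * stepCost (wordLength Δ)) + 1, 1 / M, by positivity, by positivity,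
    fun g hg => ⟨?_, ?_⟩⟩
  · rw [one_div, inv_mul_le_iff₀ hM']
    exact_mod_cast hlow g hg
  · have hup := length_le hℓ g
    have h2 : 2 ≤ tableSize g := by
      by_contra h
      rw [Nat.clog_of_right_le_one (by omega), mul_zero, mul_zero] at hup
      exact hg (eq_one_of_wordLength_eq_zero hΔ (Nat.le_zero.1 hup))
    have hlog := clog_le_two_mul_logb h2
    have hlog0 : 0 ≤ Real.logb 2 (tableSize g) :=
      Real.logb_nonneg (by norm_num) (by exact_mod_cast (by omega : 1 ≤ tableSize g))
    calc (wordLength Δ g : ℝ)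
        ≤ 44 * stepCost (wordLength Δ) * (tableSize g * Nat.clog 2 (tableSize g)) := by
          exact_mod_cast hup
      _ ≤ 44 * stepCost (wordLength Δ) * (tableSize g * (2 * Real.logb 2 (tableSize g))) := by
          gcongr
      _ = 2 * (44 * stepCost (wordLength Δ)) *
            (tableSize g * Real.logb 2 (tableSize g)) := by ring
      _ ≤ _ := by gcongr; linarith

theorem nonempty_tableSize_eq {Δ : Finset V}
    (hΔ : Subgroup.closure (Δ : Set V) = ⊤) {n : ℕ} (hn : 1 ≤ n) :
    {g : V | tableSize g = n}.Nonempty := by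
  obtain ⟨m, rfl⟩ : ∃ m, n = m + 1 := ⟨n - 1, by omega⟩
  have hfin := finite_tableSize_eq (m + 1) hΔ
  have hcat := catalan_pos m
  rw [← Set.ncard_pos hfin]
  exact (Nat.mul_pos hcat m.factorial_pos).trans_le (catalan_mul_factorial_le_ncard hfin)

theorem proportion_le {Δ : Finset V}
    (hΔ : Subgroup.closure (Δ : Set V) = ⊤) :
    ∃ C r : ℝ, 0 < C ∧ 0 < r ∧ r < 1 ∧ ∀ n : ℕ, 1 ≤ n →
      (({g : V | tableSize g = n ∧ ¬ ((tableSize g : ℝ) *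
          Real.logb (2 * (Δ.card : ℝ)) (tableSize g : ℝ) < (wordLength Δ g : ℝ))}.ncard : ℝ) /
        ({g : V | tableSize g = n}.ncard : ℝ)) ≤ C * r ^ n := by
  have hd : (1 : ℝ) ≤ Δ.card := by exact_mod_cast one_le_card_of_closure_eq_top hΔ
  obtain ⟨B, hB, hBn⟩ := exists_pow_three_mul_pow_le
  -- The ratio is at most 2|Δ| · 8n³ (e/4)^n; writing e/4 = (e/3)(3/4) leaves n³ (e/3)^n ≤ `B`.
  refine ⟨16 * Δ.card * B, 3 / 4, by positivity, by norm_num, by norm_num, fun n hn => ?_⟩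
  obtain ⟨hfin, hcard⟩ := ncard_wordLength_le_mul_logb hΔ hn
  have hnum : ({g : V | tableSize g = n ∧ ¬ ((tableSize g : ℝ) *
      Real.logb (2 * (Δ.card : ℝ)) (tableSize g : ℝ) < (wordLength Δ g : ℝ))}.ncard : ℝ) ≤
      2 * Δ.card * (n : ℝ) ^ n := by
    refine le_trans ?_ hcard
    refine Nat.cast_le.2 (Set.ncard_le_ncard ?_ hfin)
    rintro g ⟨rfl, hg⟩
    exact not_lt.1 hg
  obtain ⟨m, rfl⟩ : ∃ m, n = m + 1 := ⟨n - 1, by omega⟩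
  have hden : ((catalan m * m.factorial : ℕ) : ℝ) ≤
      ({g : V | tableSize g = m + 1}.ncard : ℝ) :=
    Nat.cast_le.2 (catalan_mul_factorial_le_ncard (finite_tableSize_eq (m + 1) hΔ))
  have hpos : (0 : ℝ) < ((catalan m * m.factorial : ℕ) : ℝ) :=
    Nat.cast_pos.2 (Nat.mul_pos (catalan_pos m) m.factorial_pos)
  have hmain := pow_self_mul_four_pow_le m
  have hBm := hBn (m + 1)
  refine (div_le_div₀ (by positivity) hnum hpos hden).trans ?_
  rw [div_le_iff₀ hpos]
  set N : ℝ := ((m + 1 : ℕ) : ℝ)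
  set c : ℝ := ((catalan m * m.factorial : ℕ) : ℝ)
  rw [← le_div_iff₀ (by positivity)] at hmain
  calc 2 * Δ.card * N ^ (m + 1)
      ≤ 2 * Δ.card * (8 * N ^ 3 * Real.exp 1 ^ (m + 1) * c / 4 ^ (m + 1)) := by gcongr
    _ = 16 * Δ.card * (N ^ 3 * (Real.exp 1 / 3) ^ (m + 1)) * (3 / 4) ^ (m + 1) * c := by
      rw [div_pow, div_pow]
      field_simp
      ring
    _ ≤ _ := by gcongr

end Thompson

theorem theorem3 (Δ : Finset Thompson.V)
    (hΔ : Subgroup.closure (Δ : Set Thompson.V) = ⊤) :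
    (∃ c c' : ℝ, 0 < c ∧ 0 < c' ∧ ∀ g : Thompson.V, g ≠ 1 →
      c' * (Thompson.tableSize g : ℝ) ≤ (Thompson.wordLength Δ g : ℝ) ∧
      (Thompson.wordLength Δ g : ℝ) ≤
        c * ((Thompson.tableSize g : ℝ) * Real.logb 2 (Thompson.tableSize g : ℝ))) ∧
    (∀ n : ℕ, 1 ≤ n →
      {g : Thompson.V | Thompson.tableSize g = n}.Finite ∧
      {g : Thompson.V | Thompson.tableSize g = n}.Nonempty) ∧
    (∃ C r : ℝ, 0 < C ∧ 0 < r ∧ r < 1 ∧ ∀ n : ℕ, 1 ≤ n →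
      (({g : Thompson.V | Thompson.tableSize g = n ∧
          ¬ ((Thompson.tableSize g : ℝ) *
              Real.logb (2 * (Δ.card : ℝ)) (Thompson.tableSize g : ℝ)
                < (Thompson.wordLength Δ g : ℝ))}.ncard : ℝ) /
        ({g : Thompson.V | Thompson.tableSize g = n}.ncard : ℝ)) ≤ C * r ^ n) :=
  ⟨Thompson.wordLength_bounds hΔ,
    fun n hn => ⟨Thompson.finite_tableSize_eq n hΔ, Thompson.nonempty_tableSize_eq hΔ hn⟩,
    Thompson.proportion_le hΔ⟩
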